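/- Conventions. Fix a set of names with co-names $a \mapsto \bar a$; labels $\alpha$ are names, co-names and $\tau$, and $\lambda,\nu$ denote labels other than $\tau$. CCS processes are $P,Q ::= 0 \mid \lambda.P \mid P\,|\,Q \mid \lambda.P+\nu.Q \mid P\backslash a$. RCCS processes are built from threads $m\rhd P$ by parallel composition and restriction, where $P$ is a CCS process and the memory $m$ is a stack $m ::= \emptyset \mid \curlyvee.m \mid \langle i,\lambda,P\rangle.m$ with identifiers $i\in\mathbb N$. The structural congruence $\equiv$ is generated by $m\rhd(P\,|\,Q)\equiv(\curlyvee.m\rhd P)\,|\,(\curlyvee.m\rhd Q)$, by $m\rhd P\backslash a\equiv(m\rhd P)\backslash a$ if $a$ is not free in $m$ (in its labels or its stored processes), and by $\alpha$-conversion of the process of a thread. The forward transitions are generated by $m\rhd(\lambda.P+Q)\to^{i:\lambda}\langle i,\lambda,Q\rangle.m\rhd P$ if $i$ does not occur in $m$ (with $+$ commutative, and $Q=0$ for the process $\lambda.P$); the backward ones are generated by the inverse of this rule, under the same condition. Both are closed under: synchronisation of an $i:\lambda$ and an $i:\bar\lambda$ transition of the two components of a parallel composition into an $i:\tau$ transition;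 an $i:\alpha$ transition of one component of a parallel composition when $i$ does not occur in the other component; restriction to $a$ when $\alpha\notin\{a,\bar a\}$; and $\equiv$. A process $R$ is reachable with origin $P=\mathrm{orig}(R)$ if a finite sequence of forward and backward transitions leads from $\emptyset\rhd P$ to $R$. A configuration structure is given by $(E,C,\ell)$: events, configurations (sets of events), and a labelling. $[\![P]\!]$ is the usual encoding of a CCS process $P$: $0$ has no events and the single configuration $\emptyset$, prefixing adds a new least event, sum is coproduct, restriction to $a$ removes the events labelled $a$ or $\bar a$, and parallel composition is the product (over partial functions) in which complementary pairs are relabelled $\tau$ and non-complementary pairs are removed. The encoding $[\![R]\!]_m$ of the memory of $R$ is a configuration structure with an identifier for each event, defined by $[\![\emptyset]\!]_m=0$, $[\![\curlyvee.m]\!]_m=[\![m]\!]_m$; $[\![\langle i,\lambda,P\rangle.m]\!]_m$ adds to $[\![m]\!]_m$ a new event $e$ with label $\lambda$ and identifier $i$, and the configurations $x\cup\{e\}$ with $x$ maximal in $[\![m]\!]_m$; $[\![m\rhd P]\!]_m=[\![m]\!]_m$, $[\![R\backslash a]\!]_m=[\![R]\!]_m$; and $[\![R_1\,|\,R_2]\!]_m$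 is the product of $[\![R_1]\!]_m$ and $[\![R_2]\!]_m$ from which one removes the pairs of events with different identifiers and the unpaired events whose identifier occurs in the other component, and in which a pair with the same identifier $i$ gets the identifier $i$ and the label $\tau$ if its labels are complementary, $\alpha$ if both its labels are $\alpha$, and the pair of its labels otherwise; unpaired events keep label and identifier. Write $\mathcal F([\![R]\!]_m)$ for the underlying configuration structure (identifiers forgotten). Statement. Let $R$ be a reachable RCCS process with origin $\mathrm{orig}(R)$. Then, up to the names of the events, $$\mathcal F([\![R]\!]_m)\subseteq[\![\mathrm{orig}(R)]\!],$$ that is: writing $\mathcal F([\![R]\!]_m)=(E_1,C_1,\ell_1)$ and $[\![\mathrm{orig}(R)]\!]=(E_2,C_2,\ell_2)$, there is an injection $f:E_1\to E_2$ such that $f(x)\in C_2$ for every $x\in C_1$, and $\ell_2(f(e))=\ell_1(e)$ for every $e\in E_1$. -/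

import Mathlib

namespace RevCCS

universe u

/-! ### Names and labels -/

/-- Visible labels: a name `a` or a co-name `ā`. -/
inductive Vis (N : Type u) : Type u
  | name (a : N) : Vis N
  | coname (a : N) : Vis N

namespace Vis

variable {N : Type u}

/-- The complement, exchanging `a` and `ā`. -/
def bar : Vis N → Vis N
  | name a => coname a
  | coname a => name a

/-- The name underlying a visible label. -/
def base : Vis N → N
  | name a => a
  | coname a => a

/-- Renaming along a permutation of the names. -/
def rename (σ : Equiv.Perm N) : Vis N → Vis N
  | name a => name (σ a)
  | coname a => coname (σ a)

end Vis

/-- The labels `L`: names, co-names and `τ`. -/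
inductive Act (N : Type u) : Type u
  | vis (v : Vis N) : Act N
  | tau : Act N

/-- `L` closed under pairing: the product of two structures labels a synchronised pair of events by
the pair of their labels. Labels in `L` are those of the form `Lab.act`. -/
inductive Lab (N : Type u) : Type u
  | act (α : Act N) : Lab N
  | pair (x y : Lab N) : Lab N

/-! ### CCS processes -/

/-- CCS processes `0`, `l.P`, `P | Q`, `l.P + k.Q` and `P \ a`. -/
inductive CCS (N : Type u) : Type u
  | nil : CCS N
  | pre (l : Vis N) (P : CCS N) : CCS N
  | par (P Q : CCS N) : CCS N
  | sum (l : Vis N) (P : CCS N) (k : Vis N) (Q : CCS N) : CCS N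
  | res (P : CCS N) (a : N) : CCS N

namespace CCS

variable {N : Type u}

/-- Free names; restriction is the only binder. -/
def freeNames : CCS N → Set N
  | nil => ∅
  | pre l P => {l.base} ∪ P.freeNames
  | par P Q => P.freeNames ∪ Q.freeNames
  | sum l P k Q => ({l.base} ∪ P.freeNames) ∪ ({k.base} ∪ Q.freeNames)
  | res P a => P.freeNames \ {a}

/-- Renaming of all names, free and bound, along a permutation. -/
def rename (σ : Equiv.Perm N) : CCS N → CCS N
  | nil => nil
  | pre l P => pre (l.rename σ) (P.rename σ)
  | par P Q => par (P.rename σ) (Q.rename σ)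
  | sum l P k Q => sum (l.rename σ) (P.rename σ) (k.rename σ) (Q.rename σ)
  | res P a => res (P.rename σ) (σ a)

open Classical in
/-- `α`-equivalence: the congruence generated by `P \ a = P{b/a} \ b` for `b` not free in `P`. The
transposition of `a` and `b` is a capture-avoiding renaming. -/
inductive AlphaEq : CCS N → CCS N → Prop
  | refl (P : CCS N) : AlphaEq P P
  | symm {P Q : CCS N} : AlphaEq P Q → AlphaEq Q P
  | trans {P Q S : CCS N} : AlphaEq P Q → AlphaEq Q S → AlphaEq P S
  | pre (l : Vis N) {P P' : CCS N} : AlphaEq P P' → AlphaEq (pre l P) (pre l P')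
  | par {P P' Q Q' : CCS N} : AlphaEq P P' → AlphaEq Q Q' → AlphaEq (par P Q) (par P' Q')
  | sum (l k : Vis N) {P P' Q Q' : CCS N} :
      AlphaEq P P' → AlphaEq Q Q' → AlphaEq (sum l P k Q) (sum l P' k Q')
  | res {P P' : CCS N} (a : N) : AlphaEq P P' → AlphaEq (res P a) (res P' a)
  | conv (P : CCS N) (a b : N) :
      b ∉ P.freeNames → AlphaEq (res P a) (res (P.rename (Equiv.swap a b)) b)

/-- `IsSum S l P Q`: the process `S` is `l.P + Q`, where `+` is taken up to commutativity and `l.P`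
alone is read as `l.P + 0`. -/
inductive IsSum : CCS N → Vis N → CCS N → CCS N → Prop
  | single (l : Vis N) (P : CCS N) : IsSum (pre l P) l P nil
  | left (l : Vis N) (P : CCS N) (k : Vis N) (Q : CCS N) : IsSum (sum l P k Q) l P (pre k Q)
  | right (l : Vis N) (P : CCS N) (k : Vis N) (Q : CCS N) : IsSum (sum l P k Q) k Q (pre l P)

end CCS

/-! ### RCCS processes -/

/-- Memory stacks `∅`, `⋎.m` and `⟨i, l, P⟩.m`; identifiers are natural numbers. -/
inductive Mem (N : Type u) : Type u
  | empty : Mem N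
  | fork (m : Mem N) : Mem N
  | event (i : ℕ) (l : Vis N) (P : CCS N) (m : Mem N) : Mem N

namespace Mem

variable {N : Type u}

/-- The identifiers occurring in a memory. -/
def ids : Mem N → Set ℕ
  | empty => ∅
  | fork m => m.ids
  | event i _ _ m => {i} ∪ m.ids

/-- The names occurring free in a memory, in its labels or in its stored processes. -/
def freeNames : Mem N → Set N
  | empty => ∅
  | fork m => m.freeNames
  | event _ l P m => {l.base} ∪ P.freeNames ∪ m.freeNames

end Mem

/-- RCCS processes: threads `m ▷ P`, parallel compositions and restrictions. -/
inductive RCCS (N : Type u) : Type u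
  | thread (m : Mem N) (P : CCS N) : RCCS N
  | par (R S : RCCS N) : RCCS N
  | res (R : RCCS N) (a : N) : RCCS N

namespace RCCS

variable {N : Type u}

/-- The identifiers occurring in a process. -/
def ids : RCCS N → Set ℕ
  | thread m _ => m.ids
  | par R S => R.ids ∪ S.ids
  | res R _ => R.ids

/-- Structural congruence: distribution of memory, scope of restriction and `α`-conversion. -/
inductive Congr : RCCS N → RCCS N → Prop
  | refl (R : RCCS N) : Congr R R
  | symm {R S : RCCS N} : Congr R S → Congr S R
  | trans {R S T : RCCS N} : Congr R S → Congr S T → Congr R T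
  | par {R R' S S' : RCCS N} : Congr R R' → Congr S S' → Congr (par R S) (par R' S')
  | res {R R' : RCCS N} (a : N) : Congr R R' → Congr (res R a) (res R' a)
  | distribution (m : Mem N) (P Q : CCS N) :
      Congr (thread m (CCS.par P Q)) (par (thread m.fork P) (thread m.fork Q))
  | scope (m : Mem N) (P : CCS N) (a : N) :
      a ∉ m.freeNames → Congr (thread m (CCS.res P a)) (res (thread m P) a)
  | alpha (m : Mem N) {P Q : CCS N} : CCS.AlphaEq P Q → Congr (thread m P) (thread m Q)

end RCCS

/-- Direction of a transition. -/
inductive Dir : Type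
  | forward : Dir
  | backward : Dir

namespace RCCS

variable {N : Type u}

/-- The labelled transition system; `Step d i α R S` is the transition `R → S` with identifier `i`
and label `α`, in direction `d`. -/
inductive Step : Dir → ℕ → Act N → RCCS N → RCCS N → Prop
  | act {i : ℕ} {m : Mem N} {l : Vis N} {S P Q : CCS N} :
      CCS.IsSum S l P Q → i ∉ m.ids →
      Step Dir.forward i (Act.vis l) (thread m S) (thread (Mem.event i l Q m) P)
  | actBack {i : ℕ} {m : Mem N} {l : Vis N} {S P Q : CCS N} :
      CCS.IsSum S l P Q → i ∉ m.ids →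
      Step Dir.backward i (Act.vis l) (thread (Mem.event i l Q m) P) (thread m S)
  | syn {d : Dir} {i : ℕ} {l : Vis N} {R R' S S' : RCCS N} :
      Step d i (Act.vis l) R R' → Step d i (Act.vis l.bar) S S' →
      Step d i Act.tau (par R S) (par R' S')
  | parLeft {d : Dir} {i : ℕ} {α : Act N} {R R' S : RCCS N} :
      Step d i α R R' → i ∉ S.ids → Step d i α (par R S) (par R' S)
  | parRight {d : Dir} {i : ℕ} {α : Act N} {R S S' : RCCS N} :
      Step d i α S S' → i ∉ R.ids → Step d i α (par R S) (par R S')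
  | res {d : Dir} {i : ℕ} {α : Act N} {R R' : RCCS N} {a : N} :
      Step d i α R R' → α ≠ Act.vis (Vis.name a) → α ≠ Act.vis (Vis.coname a) →
      Step d i α (res R a) (res R' a)
  | congr {d : Dir} {i : ℕ} {α : Act N} {R₁ R R' R₁' : RCCS N} :
      Congr R₁ R → Step d i α R R' → Congr R' R₁' → Step d i α R₁ R₁'

/-- `IsOrigin P R`: the process `R` is reachable with origin `P`, that is, a finite sequence of
forward and backward transitions leads from `∅ ▷ P` to `R`. -/
def IsOrigin (P : CCS N) (R : RCCS N) : Prop :=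
  Relation.ReflTransGen (fun S T : RCCS N => ∃ d i α, Step d i α S T)
    (thread Mem.empty P) R

end RCCS

/-! ### Configuration structures and their operations -/

/-- The data `(E, C, ℓ)` of a configuration structure: events, configurations, labelling. -/
structure ConfStr (N : Type u) where
  Ev : Type
  conf : Set (Set Ev)
  lab : Ev → Lab N

/-- The product `A ×⋆ B` of sets and partial functions: pairs `(a, ⋆)`, `(⋆, b)` and `(a, b)`. -/
inductive StarProd (A B : Type) : Type
  | left (a : A) : StarProd A B
  | right (b : B) : StarProd A B
  | both (a : A) (b : B) : StarProd A B

namespace StarProd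

variable {A B : Type}

/-- First projection, with `none` for `⋆`. -/
def fst : StarProd A B → Option A
  | left a => some a
  | right _ => none
  | both a _ => some a

/-- Second projection, with `none` for `⋆`. -/
def snd : StarProd A B → Option B
  | left _ => none
  | right b => some b
  | both _ b => some b

/-- Projection of a set of events to the first component. -/
def proj₁ (x : Set (StarProd A B)) : Set A := {a | ∃ e ∈ x, e.fst = some a}

/-- Projection of a set of events to the second component. -/
def proj₂ (x : Set (StarProd A B)) : Set B := {b | ∃ e ∈ x, e.snd = some b}

end StarProd

namespace ConfStr

variable {N : Type u}

/-- `x` is a maximal configuration. -/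
def IsMaximal (C : ConfStr N) (x : Set C.Ev) : Prop :=
  x ∈ C.conf ∧ ∀ y ∈ C.conf, x ⊆ y → x = y

/-- The structure `0` without events; its only configuration is the empty one. -/
def zero : ConfStr N where
  Ev := Empty
  conf := {∅}
  lab := fun e => e.elim

/-- Product. -/
def prod (C₁ C₂ : ConfStr N) : ConfStr N where
  Ev := StarProd C₁.Ev C₂.Ev
  conf := {x |
    (StarProd.proj₁ x ∈ C₁.conf ∧ StarProd.proj₂ x ∈ C₂.conf) ∧
    (∀ e ∈ x, ∀ e' ∈ x,
      ((∃ a, e.fst = some a ∧ e'.fst = some a) ∨ (∃ b, e.snd = some b ∧ e'.snd = some b)) →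
      e = e') ∧
    (∀ e ∈ x, ∃ z, z ⊆ x ∧ z.Finite ∧
      StarProd.proj₁ z ∈ C₁.conf ∧ StarProd.proj₂ z ∈ C₂.conf ∧ e ∈ z) ∧
    (∀ e ∈ x, ∀ e' ∈ x, e ≠ e' → ∃ z, z ⊆ x ∧
      StarProd.proj₁ z ∈ C₁.conf ∧ StarProd.proj₂ z ∈ C₂.conf ∧ (e ∈ z ↔ e' ∉ z))}
  lab
    | StarProd.left a => C₁.lab a
    | StarProd.right b => C₂.lab b
    | StarProd.both a b => Lab.pair (C₁.lab a) (C₂.lab b)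

/-- Relabelling along `r`. -/
def relabel (C : ConfStr N) (r : C.Ev → Lab N) : ConfStr N where
  Ev := C.Ev
  conf := C.conf
  lab := r

/-- Restriction to a set `F` of events. -/
def restrict (C : ConfStr N) (F : Set C.Ev) : ConfStr N where
  Ev := F
  conf := {x | Subtype.val '' x ∈ C.conf}
  lab := fun e => C.lab e

/-- Restriction to a name `a`: the events labelled `a` or `ā` are removed. -/
def restrictName (C : ConfStr N) (a : N) : ConfStr N :=
  C.restrict {e | C.lab e ≠ Lab.act (Act.vis (Vis.name a)) ∧
    C.lab e ≠ Lab.act (Act.vis (Vis.coname a))}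

/-- Relabelling along a partial `r`, with `none` for `⊥`, followed by the restriction to the events
on which `r` is not `⊥`. -/
def relabelRestrict (C : ConfStr N) (r : C.Ev → Option (Lab N)) : ConfStr N :=
  (C.restrict {e | (r e).isSome}).relabel fun e => (r e.1).get e.2

open Classical in
/-- The relabelling of the parallel composition: labels in `L` are kept, pairs of complementary
labels become `τ`, everything else becomes `⊥` (`none`). -/
noncomputable def synchronise : Lab N → Option (Lab N)
  | Lab.act α => some (Lab.act α)
  | Lab.pair (Lab.act (Act.vis l)) (Lab.act (Act.vis k)) =>
      if k = l.bar then some (Lab.act Act.tau) else none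
  | _ => none

/-- Parallel composition. -/
noncomputable def par (C₁ C₂ : ConfStr N) : ConfStr N :=
  (C₁.prod C₂).relabelRestrict fun e => synchronise ((C₁.prod C₂).lab e)

/-- Coproduct. -/
def coprod (C₁ C₂ : ConfStr N) : ConfStr N where
  Ev := C₁.Ev ⊕ C₂.Ev
  conf := {x | (∃ y ∈ C₁.conf, x = Sum.inl '' y) ∨ (∃ y ∈ C₂.conf, x = Sum.inr '' y)}
  lab := Sum.elim C₁.lab C₂.lab

/-- Prefixing `l.C`; the new event is `none`. -/
def guarded (l : Vis N) (C : ConfStr N) : ConfStr N where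
  Ev := Option C.Ev
  conf := {x | x = ∅ ∨ ∃ y ∈ C.conf, x = insert none (some '' y)}
  lab
    | none => Lab.act (Act.vis l)
    | some e => C.lab e

/-- Inclusion of configuration structures. Events matter only up to renaming, so `C₁ ⊆ C₂` holds
along an injection `f` of the events: after renaming the events of `C₁` along `f`, the events, the
configurations and the labelling of `C₁` are contained in those of `C₂`. -/
def Included (C₁ C₂ : ConfStr N) : Prop :=
  ∃ f : C₁.Ev → C₂.Ev, Function.Injective f ∧
    (∀ x ∈ C₁.conf, f '' x ∈ C₂.conf) ∧ ∀ e, C₂.lab (f e) = C₁.lab e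

end ConfStr

/-- The encoding of a CCS process as a configuration structure. -/
noncomputable def CCS.enc {N : Type u} : CCS N → ConfStr N
  | CCS.nil => ConfStr.zero
  | CCS.pre l P => ConfStr.guarded l P.enc
  | CCS.par P Q => P.enc.par Q.enc
  | CCS.sum l P k Q => (ConfStr.guarded l P.enc).coprod (ConfStr.guarded k Q.enc)
  | CCS.res P a => P.enc.restrictName a

/-! ### Identified configuration structures and the encoding of memories -/

/-- The data of an identified configuration structure: a configuration structure, its underlying
one, with an identifier in `I` for each event. -/
structure IdConfStr (N : Type u) (I : Type) where
  underlying : ConfStr N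
  ident : underlying.Ev → I

namespace IdConfStr

variable {N : Type u}

/-- The identified structure `0`. -/
def zero : IdConfStr N ℕ where
  underlying := ConfStr.zero
  ident := fun e => Empty.elim e

/-- Product; `none` is the identifier `m⋆` of an absent component. -/
def prod {I J : Type} (D₁ : IdConfStr N I) (D₂ : IdConfStr N J) :
    IdConfStr N (Option I × Option J) where
  underlying := D₁.underlying.prod D₂.underlying
  ident
    | StarProd.left a => (some (D₁.ident a), none)
    | StarProd.right b => (none, some (D₂.ident b))
    | StarProd.both a b => (some (D₁.ident a), some (D₂.ident b))

open Classical in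
/-- The relabelling of the parallel composition, with `none` for `⊥`. Events with different
identifiers do not pair, and an event does not occur alone if an event of the other component has
its identifier. Among pairs with the same identifier, complementary labels give `τ` (a
synchronisation) and equal labels `α` give `α` (a fork). Any other event keeps its label. -/
noncomputable def validate (D₁ D₂ : IdConfStr N ℕ) :
    StarProd D₁.underlying.Ev D₂.underlying.Ev → Option (Lab N)
  | StarProd.left a =>
      if ∃ b, D₁.ident a = D₂.ident b then none else some (D₁.underlying.lab a)
  | StarProd.right b =>
      if ∃ a, D₁.ident a = D₂.ident b then none else some (D₂.underlying.lab b)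
  | StarProd.both a b =>
      if D₁.ident a ≠ D₂.ident b then none
      else if ∃ l : Vis N, D₁.underlying.lab a = Lab.act (Act.vis l) ∧
          D₂.underlying.lab b = Lab.act (Act.vis l.bar) then some (Lab.act Act.tau)
      else if ∃ α : Act N, D₁.underlying.lab a = Lab.act α ∧ D₂.underlying.lab b = Lab.act α then
        some (D₁.underlying.lab a)
      else some (Lab.pair (D₁.underlying.lab a) (D₂.underlying.lab b))

/-- The identifier `i` denoted by `(i, m⋆)`, `(m⋆, i)` or `(i, i)`; no other pair is the identifier
of an event of a parallel composition. -/
def collapse (p : Option ℕ × Option ℕ) : ℕ := (p.1.or p.2).getD 0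

/-- Parallel composition. -/
noncomputable def par (D₁ D₂ : IdConfStr N ℕ) : IdConfStr N ℕ where
  underlying := (D₁.prod D₂).underlying.relabelRestrict (validate D₁ D₂)
  ident := fun e => collapse ((D₁.prod D₂).ident e.1)

/-- The structure of `⟨i, l, P⟩.m` from that of `m`: a new event `none`, with label `l` and
identifier `i`, is added on top of the maximal configurations. -/
def push (i : ℕ) (l : Vis N) (D : IdConfStr N ℕ) : IdConfStr N ℕ where
  underlying :=
    { Ev := Option D.underlying.Ev
      conf := {x | (∃ y ∈ D.underlying.conf, x = some '' y) ∨
        ∃ y, D.underlying.IsMaximal y ∧ x = insert none (some '' y)}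
      lab := fun
        | none => Lab.act (Act.vis l)
        | some e => D.underlying.lab e }
  ident
    | none => i
    | some e => D.ident e

end IdConfStr

/-- The encoding of a memory. -/
def Mem.enc {N : Type u} : Mem N → IdConfStr N ℕ
  | Mem.empty => IdConfStr.zero
  | Mem.fork m => m.enc
  | Mem.event i l _ m => IdConfStr.push i l m.enc

/-- The encoding of the memory of an RCCS process. -/
noncomputable def RCCS.encMem {N : Type u} : RCCS N → IdConfStr N ℕ
  | RCCS.thread m _ => m.enc
  | RCCS.par R S => R.encMem.par S.encMem
  | RCCS.res R _ => R.encMem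

end RevCCS

namespace RevCCS

universe u

variable {N : Type u}

/-! ### Renaming of labels -/

namespace Vis

/-! The origin cannot be read off `R` syntactically: undoing all events of `R` gives different
processes, depending on how `≡` is used on the way. For a thread with last event `⟨i, l, Q⟩`,
undoing it below a restriction to `a` gives `l.(P \ a) + Q`, while moving the restriction outwards
before undoing gives `(l.P + Q) \ a`. Since `a` does not occur in the memory, the two have
isomorphic encodings. All processes are therefore compared by `CCS.Equivalent`, the isomorphism of
encodings, which also absorbs `α`-conversion and the commutativity of sums.

The invariant is `RCCS.Rollback m P R`: up to `Equivalent`, undoing the events of `R` outside `m`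
leads to `m ▷ P`. It also records that identifiers shared across a parallel composition, outside the
common memory, carry complementary labels, and that no action under a restriction uses the
restricted name. The invariant is stable under `≡` (`congr_iff`) and forward steps (`forward`). A
backward step either preserves it or undoes the last event of `m` (`backward`); the latter is
impossible for `m = ∅`. Hence every reachable `R` satisfies `Rollback ∅ P R` (`of_isOrigin`).

By induction on such a derivation, the events of the memory of `R` embed into those of `m` together
with those of the encoding of `P`, where the latter occur only after all of `m` (`Embeds`,
`exists_embeds`). Undoing an event turns the last event of `m` into the least event of a prefix; a
parallel composition glues the two copies of `m` and maps the remaining events into the product. For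
`m = ∅` only the encoding of `P` is left. -/

theorem bar_ne (l : Vis N) : l.bar ≠ l := by
  cases l <;> simp [bar]

theorem bar_rename (σ : Equiv.Perm N) (l : Vis N) : (l.rename σ).bar = l.bar.rename σ := by
  cases l <;> rfl

theorem rename_one (l : Vis N) : l.rename 1 = l := by
  cases l <;> rfl

theorem rename_injective (σ : Equiv.Perm N) : Function.Injective (rename σ) := by
  intro l k h
  cases l <;> cases k <;> simp_all [rename]

theorem base_ne_iff (l : Vis N) (a : N) : l.base ≠ a ↔ l ≠ name a ∧ l ≠ coname a := by
  cases l <;> simp [base]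

end Vis

/-- Renaming of the names in an action. -/
def Act.rename (σ : Equiv.Perm N) : Act N → Act N
  | vis v => vis (v.rename σ)
  | tau => tau

/-- Renaming of the names in a label. -/
def Lab.rename (σ : Equiv.Perm N) : Lab N → Lab N
  | act α => act (α.rename σ)
  | pair x y => pair (x.rename σ) (y.rename σ)

theorem Act.rename_one (α : Act N) : α.rename 1 = α := by
  cases α <;> simp [rename, Vis.rename_one]

theorem Lab.rename_one (x : Lab N) : x.rename 1 = x := by
  induction x <;> simp_all [rename, Act.rename_one]

theorem Vis.rename_rename (σ ρ : Equiv.Perm N) (l : Vis N) :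
    (l.rename σ).rename ρ = l.rename (ρ * σ) := by
  cases l <;> rfl

theorem Lab.rename_rename (σ ρ : Equiv.Perm N) (x : Lab N) :
    (x.rename σ).rename ρ = x.rename (ρ * σ) := by
  induction x with
  | act α => cases α <;> simp [rename, Act.rename, Vis.rename_rename]
  | pair x y hx hy => simp [rename, hx, hy]

theorem Lab.rename_eq_name_iff (σ : Equiv.Perm N) (x : Lab N) (a : N) :
    x.rename σ = act (Act.vis (Vis.name (σ a))) ↔ x = act (Act.vis (Vis.name a)) := by
  rcases x with (_ | _) | _
  · rename_i v
    cases v <;> simp [rename, Act.rename, Vis.rename]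
  all_goals simp [rename, Act.rename]

theorem Lab.rename_eq_coname_iff (σ : Equiv.Perm N) (x : Lab N) (a : N) :
    x.rename σ = act (Act.vis (Vis.coname (σ a))) ↔ x = act (Act.vis (Vis.coname a)) := by
  rcases x with (_ | _) | _
  · rename_i v
    cases v <;> simp [rename, Act.rename, Vis.rename]
  all_goals simp [rename, Act.rename]

/-! ### Images of sets of events -/

theorem image_map_insert_none {A B : Type} (f : A → B) (y : Set A) :
    Option.map f '' (insert none (some '' y)) = insert none (some '' (f '' y)) := by
  rw [Set.image_insert_eq, Set.image_image, Set.image_image]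
  rfl

theorem image_sumMap_inl {A B A' B' : Type} (f : A → A') (g : B → B') (y : Set A) :
    Sum.map f g '' (Sum.inl '' y) = Sum.inl '' (f '' y) := by
  rw [Set.image_image, Set.image_image]
  rfl

theorem image_sumMap_inr {A B A' B' : Type} (f : A → A') (g : B → B') (y : Set B) :
    Sum.map f g '' (Sum.inr '' y) = Sum.inr '' (g '' y) := by
  rw [Set.image_image, Set.image_image]
  rfl

theorem exists_eq_image_val {A : Type} {F : Set A} {y : Set A} (h : y ⊆ F) :
    ∃ z : Set F, y = Subtype.val '' z :=
  ⟨Subtype.val ⁻¹' y, by rw [Subtype.image_preimage_coe, Set.inter_eq_right.2 h]⟩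

/-! ### Partial maps between products -/

namespace StarProd

variable {A B A' B' : Type}

theorem ext_proj {s t : StarProd A B} (h₁ : s.fst = t.fst) (h₂ : s.snd = t.snd) : s = t := by
  cases s <;> cases t <;> simp_all [fst, snd]

theorem fst_or_snd (s : StarProd A B) : (∃ a, s.fst = some a) ∨ ∃ b, s.snd = some b := by
  cases s <;> simp [fst, snd]

/-- The pair of two optional components, undefined if both are absent. -/
def mk? : Option A → Option B → Option (StarProd A B)
  | some a, some b => some (both a b)
  | some a, none => some (left a)
  | none, some b => some (right b)
  | none, none => none

theorem mk?_eq_some_iff (o : Option A) (o' : Option B) (s : StarProd A B) :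
    mk? o o' = some s ↔ s.fst = o ∧ s.snd = o' := by
  cases o <;> cases o' <;> cases s <;> simp [mk?, fst, snd, eq_comm]

/-- The action of two partial maps on a product. -/
def pmap (p : A → Option A') (q : B → Option B') (s : StarProd A B) :
    Option (StarProd A' B') :=
  mk? (s.fst.bind p) (s.snd.bind q)

theorem pmap_eq_some_iff (p : A → Option A') (q : B → Option B') (s : StarProd A B)
    (t : StarProd A' B') :
    pmap p q s = some t ↔ t.fst = s.fst.bind p ∧ t.snd = s.snd.bind q :=
  mk?_eq_some_iff _ _ _

theorem exists_pmap_of_fst {p : A → Option A'} (q : B → Option B') {s : StarProd A B} {a : A}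
    {a' : A'} (h : s.fst = some a) (h' : p a = some a') :
    ∃ t, pmap p q s = some t ∧ t.fst = some a' := by
  cases s with
  | left x => exact ⟨left a', by simp_all [pmap_eq_some_iff, fst, snd], rfl⟩
  | right x => simp [fst] at h
  | both x y =>
    simp only [pmap_eq_some_iff]
    cases hq : q y with
    | none => exact ⟨left a', by simp_all [fst, snd], rfl⟩
    | some b' => exact ⟨both a' b', by simp_all [fst, snd], rfl⟩

theorem exists_pmap_of_snd (p : A → Option A') {q : B → Option B'} {s : StarProd A B} {b : B}
    {b' : B'} (h : s.snd = some b) (h' : q b = some b') :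
    ∃ t, pmap p q s = some t ∧ t.snd = some b' := by
  cases s with
  | right x => exact ⟨right b', by simp_all [pmap_eq_some_iff, fst, snd], rfl⟩
  | left x => simp [snd] at h
  | both x y =>
    simp only [pmap_eq_some_iff]
    cases hq : p x with
    | none => exact ⟨right b', by simp_all [fst, snd], rfl⟩
    | some a' => exact ⟨both a' b', by simp_all [fst, snd], rfl⟩

/-- The image of a set under a partial map. -/
def _root_.RevCCS.pimage {A B : Type} (p : A → Option B) (x : Set A) : Set B :=
  {b | ∃ a ∈ x, p a = some b}

theorem proj₁_pimage (p : A → Option A') (q : B → Option B') (x : Set (StarProd A B)) :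
    proj₁ (pimage (pmap p q) x) = pimage p (proj₁ x) := by
  ext c
  constructor
  · rintro ⟨t, ⟨s, hs, hst⟩, ht⟩
    rw [pmap_eq_some_iff] at hst
    obtain ⟨a, ha, hc⟩ := Option.bind_eq_some_iff.1 (hst.1.symm.trans ht)
    exact ⟨a, ⟨s, hs, ha⟩, hc⟩
  · rintro ⟨a, ⟨s, hs, ha⟩, hc⟩
    obtain ⟨t, h, ht⟩ := exists_pmap_of_fst q ha hc
    exact ⟨t, ⟨s, hs, h⟩, ht⟩

theorem proj₂_pimage (p : A → Option A') (q : B → Option B') (x : Set (StarProd A B)) :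
    proj₂ (pimage (pmap p q) x) = pimage q (proj₂ x) := by
  ext c
  constructor
  · rintro ⟨t, ⟨s, hs, hst⟩, ht⟩
    rw [pmap_eq_some_iff] at hst
    obtain ⟨a, ha, hc⟩ := Option.bind_eq_some_iff.1 (hst.2.symm.trans ht)
    exact ⟨a, ⟨s, hs, ha⟩, hc⟩
  · rintro ⟨a, ⟨s, hs, ha⟩, hc⟩
    obtain ⟨t, h, ht⟩ := exists_pmap_of_snd p ha hc
    exact ⟨t, ⟨s, hs, h⟩, ht⟩

end StarProd

theorem pimage_finite {A B : Type} (p : A → Option B) {x : Set A} (hx : x.Finite) :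
    (pimage p x).Finite := by
  refine (hx.image p).preimage (f := some) (Option.some_injective _).injOn |>.subset ?_
  rintro b ⟨a, ha, h⟩
  exact ⟨a, ha, h⟩

theorem pimage_mono {A B : Type} (p : A → Option B) {x y : Set A} (h : x ⊆ y) :
    pimage p x ⊆ pimage p y := by
  rintro b ⟨a, ha, h'⟩
  exact ⟨a, h ha, h'⟩

theorem pimage_some {A B : Type} (f : A → B) (x : Set A) :
    pimage (fun a => some (f a)) x = f '' x := by
  ext b
  simp [pimage]

namespace ConfStr

/-- Partial maps which are injective where defined and preserve configurations in each component
preserve the configurations of a product. -/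
theorem pimage_mem_prod_conf {A B C D : ConfStr N} {p : A.Ev → Option C.Ev}
    {q : B.Ev → Option D.Ev}
    (hp : ∀ a a' c, p a = some c → p a' = some c → a = a')
    (hq : ∀ b b' d, q b = some d → q b' = some d → b = b')
    (hpc : ∀ x ∈ A.conf, pimage p x ∈ C.conf) (hqc : ∀ x ∈ B.conf, pimage q x ∈ D.conf)
    {x : Set (StarProd A.Ev B.Ev)} (hx : x ∈ (A.prod B).conf) :
    pimage (StarProd.pmap p q) x ∈ (C.prod D).conf := by
  obtain ⟨⟨hx₁, hx₂⟩, hinj, hfin, hcoin⟩ := hx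
  -- `pmap p q` is not injective on the whole product: `left a` and `both a b` have the same image
  -- when `p a` is defined and `q b` is not. On a configuration `x` it is, because events whose
  -- images share a component already share one, and distinct events of `x` never do.
  have key : ∀ e ∈ x, ∀ e' ∈ x, ∀ s s', StarProd.pmap p q e = some s →
      StarProd.pmap p q e' = some s' →
      ((∃ a, s.fst = some a ∧ s'.fst = some a) ∨ (∃ b, s.snd = some b ∧ s'.snd = some b)) →
      e = e' := by
    intro e he e' he' s s' hs hs' h
    rw [StarProd.pmap_eq_some_iff] at hs hs'
    refine hinj e he e' he' ?_
    rcases h with ⟨c, h, h'⟩ | ⟨c, h, h'⟩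
    · obtain ⟨a, ha, hac⟩ := Option.bind_eq_some_iff.1 (hs.1.symm.trans h)
      obtain ⟨a', ha', hac'⟩ := Option.bind_eq_some_iff.1 (hs'.1.symm.trans h')
      obtain rfl := hp _ _ _ hac hac'
      exact Or.inl ⟨a, ha, ha'⟩
    · obtain ⟨a, ha, hac⟩ := Option.bind_eq_some_iff.1 (hs.2.symm.trans h)
      obtain ⟨a', ha', hac'⟩ := Option.bind_eq_some_iff.1 (hs'.2.symm.trans h')
      obtain rfl := hq _ _ _ hac hac'
      exact Or.inr ⟨a, ha, ha'⟩
  have keySelf : ∀ e ∈ x, ∀ e' ∈ x, ∀ s, StarProd.pmap p q e = some s →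
      StarProd.pmap p q e' = some s → e = e' := by
    intro e he e' he' s hs hs'
    refine key e he e' he' s s hs hs' ?_
    rcases s.fst_or_snd with ⟨a, h⟩ | ⟨b, h⟩
    · exact Or.inl ⟨a, h, h⟩
    · exact Or.inr ⟨b, h, h⟩
  refine ⟨⟨?_, ?_⟩, ?_, ?_, ?_⟩
  · rw [StarProd.proj₁_pimage]; exact hpc _ hx₁
  · rw [StarProd.proj₂_pimage]; exact hqc _ hx₂
  · rintro s ⟨e, he, hs⟩ s' ⟨e', he', hs'⟩ h
    obtain rfl := key e he e' he' s s' hs hs' h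
    exact Option.some_injective _ (hs.symm.trans hs')
  · rintro s ⟨e, he, hs⟩
    obtain ⟨z, hzx, hz, hz₁, hz₂, hez⟩ := hfin e he
    refine ⟨pimage (StarProd.pmap p q) z, pimage_mono _ hzx, pimage_finite _ hz, ?_, ?_,
      e, hez, hs⟩
    · rw [StarProd.proj₁_pimage]; exact hpc _ hz₁
    · rw [StarProd.proj₂_pimage]; exact hqc _ hz₂
  · rintro s ⟨e, he, hs⟩ s' ⟨e', he', hs'⟩ hne
    have hee : e ≠ e' := by
      rintro rfl
      exact hne (Option.some_injective _ (hs.symm.trans hs'))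
    obtain ⟨z, hzx, hz₁, hz₂, hiff⟩ := hcoin e he e' he' hee
    -- Injectivity on `x` lets a subconfiguration separating `e` from `e'` be carried over to their
    -- images.
    have mem : ∀ e ∈ x, ∀ s, StarProd.pmap p q e = some s →
        (s ∈ pimage (StarProd.pmap p q) z ↔ e ∈ z) := by
      intro e he s hs
      constructor
      · rintro ⟨e'', he'', hs''⟩
        rwa [keySelf e he e'' (hzx he'') s hs hs'']
      · intro h
        exact ⟨e, h, hs⟩
    refine ⟨pimage (StarProd.pmap p q) z, pimage_mono _ hzx, ?_, ?_, ?_⟩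
    · rw [StarProd.proj₁_pimage]; exact hpc _ hz₁
    · rw [StarProd.proj₂_pimage]; exact hqc _ hz₂
    · rw [mem e he s hs, mem e' he' s' hs', hiff]

/-! ### Isomorphisms of configuration structures -/

/-- `Iso σ C D`: a bijection between the events of `C` and `D` which identifies the configurations
and renames the labels along `σ`. -/
def Iso (σ : Equiv.Perm N) (C D : ConfStr N) : Prop :=
  ∃ f : C.Ev ≃ D.Ev, (∀ x, f '' x ∈ D.conf ↔ x ∈ C.conf) ∧
    ∀ e, D.lab (f e) = (C.lab e).rename σ

namespace Iso

variable {σ ρ : Equiv.Perm N} {C C' D D' : ConfStr N}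

theorem refl (C : ConfStr N) : Iso 1 C C :=
  ⟨Equiv.refl _, by simp, by simp [Lab.rename_one]⟩

theorem symm' (h : Iso σ C D) : Iso σ⁻¹ D C := by
  obtain ⟨f, hf, hl⟩ := h
  refine ⟨f.symm, fun x => ?_, fun e => ?_⟩
  · rw [← hf, Equiv.image_symm_eq_preimage, Set.image_preimage_eq _ f.surjective]
  · have := hl (f.symm e)
    rw [Equiv.apply_symm_apply] at this
    rw [this, Lab.rename_rename, inv_mul_cancel, Lab.rename_one]

theorem symm (h : Iso 1 C D) : Iso 1 D C := by
  simpa using h.symm'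

theorem trans {S : ConfStr N} (h : Iso 1 C D) (h' : Iso 1 D S) : Iso 1 C S := by
  obtain ⟨f, hf, hl⟩ := h
  obtain ⟨g, hg, hl'⟩ := h'
  refine ⟨f.trans g, fun x => ?_, fun e => ?_⟩
  · rw [← hf, ← hg, Equiv.coe_trans, Set.image_comp]
  · simp [hl, hl', Lab.rename_one]

theorem included (h : Iso 1 C D) : C.Included D := by
  obtain ⟨f, hf, hl⟩ := h
  exact ⟨f, f.injective, fun x hx => (hf x).2 hx, fun e => by rw [hl, Lab.rename_one]⟩

/-- A renaming which fixes all labels is irrelevant. -/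
theorem of_fixed (h : Iso σ C D) (hσ : ∀ e, (C.lab e).rename σ = C.lab e) : Iso 1 C D := by
  obtain ⟨f, hf, hl⟩ := h
  exact ⟨f, hf, fun e => by rw [hl, hσ, Lab.rename_one]⟩

theorem guarded (h : Iso σ C D) (l : Vis N) :
    Iso σ (ConfStr.guarded l C) (ConfStr.guarded (l.rename σ) D) := by
  obtain ⟨f, hf, hl⟩ := h
  refine ⟨Equiv.optionCongr f, fun (x : Set (Option C.Ev)) => ?_, fun e => ?_⟩
  · have hinj : Function.Injective (Set.image (Option.map f)) :=
      Set.image_injective.2 (Option.map_injective f.injective)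
    change (Option.map f '' x = ∅ ∨ ∃ y ∈ D.conf, Option.map f '' x = insert none (some '' y)) ↔
      (x = ∅ ∨ ∃ y ∈ C.conf, x = insert none (some '' y))
    refine or_congr Set.image_eq_empty ⟨?_, ?_⟩
    · rintro ⟨y, hy, h⟩
      refine ⟨f.symm '' y, ?_, hinj ?_⟩
      · rw [← hf, Equiv.image_symm_eq_preimage, Set.image_preimage_eq _ f.surjective]
        exact hy
      · rw [image_map_insert_none, Equiv.image_symm_eq_preimage, Set.image_preimage_eq _ f.surjective]
        exact h
    · rintro ⟨y, hy, rfl⟩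
      exact ⟨f '' y, (hf y).2 hy, image_map_insert_none f y⟩
  · cases e with
    | none => rfl
    | some e => exact hl e

theorem coprod (h : Iso σ C D) (h' : Iso σ C' D') :
    Iso σ (C.coprod C') (D.coprod D') := by
  obtain ⟨f, hf, hl⟩ := h
  obtain ⟨g, hg, hl'⟩ := h'
  have hinj : Function.Injective (Set.image (Sum.map f g)) :=
    Set.image_injective.2 (f.injective.sumMap g.injective)
  refine ⟨Equiv.sumCongr f g, fun (x : Set (C.Ev ⊕ C'.Ev)) => ?_, fun e => ?_⟩
  · change ((∃ y ∈ D.conf, Sum.map f g '' x = Sum.inl '' y) ∨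
      ∃ y ∈ D'.conf, Sum.map f g '' x = Sum.inr '' y) ↔
      ((∃ y ∈ C.conf, x = Sum.inl '' y) ∨ ∃ y ∈ C'.conf, x = Sum.inr '' y)
    refine or_congr ⟨?_, ?_⟩ ⟨?_, ?_⟩
    · rintro ⟨y, hy, h⟩
      refine ⟨f.symm '' y, ?_, hinj ?_⟩
      · rw [← hf, Equiv.image_symm_eq_preimage, Set.image_preimage_eq _ f.surjective]
        exact hy
      · rw [image_sumMap_inl, Equiv.image_symm_eq_preimage, Set.image_preimage_eq _ f.surjective]
        exact h
    · rintro ⟨y, hy, rfl⟩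
      exact ⟨f '' y, (hf y).2 hy, image_sumMap_inl f g y⟩
    · rintro ⟨y, hy, h⟩
      refine ⟨g.symm '' y, ?_, hinj ?_⟩
      · rw [← hg, Equiv.image_symm_eq_preimage, Set.image_preimage_eq _ g.surjective]
        exact hy
      · rw [image_sumMap_inr, Equiv.image_symm_eq_preimage, Set.image_preimage_eq _ g.surjective]
        exact h
    · rintro ⟨y, hy, rfl⟩
      exact ⟨g '' y, (hg y).2 hy, image_sumMap_inr f g y⟩
  · cases e with
    | inl e => exact hl e
    | inr e => exact hl' e

theorem coprod_comm (C D : ConfStr N) : Iso 1 (C.coprod D) (D.coprod C) := by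
  refine ⟨Equiv.sumComm _ _, fun (x : Set (C.Ev ⊕ D.Ev)) => ?_, fun e => ?_⟩
  · have hinj : Function.Injective (Set.image (Sum.swap : C.Ev ⊕ D.Ev → _)) :=
      Set.image_injective.2 (Equiv.sumComm _ _).injective
    have hl : ∀ y : Set C.Ev, (Sum.swap : C.Ev ⊕ D.Ev → _) '' (Sum.inl '' y) = Sum.inr '' y := by
      intro y; simp [Set.image_image]
    have hr : ∀ y : Set D.Ev, (Sum.swap : C.Ev ⊕ D.Ev → _) '' (Sum.inr '' y) = Sum.inl '' y := by
      intro y; simp [Set.image_image]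
    change ((∃ y ∈ D.conf, Sum.swap '' x = Sum.inl '' y) ∨
      ∃ y ∈ C.conf, Sum.swap '' x = Sum.inr '' y) ↔
      ((∃ y ∈ C.conf, x = Sum.inl '' y) ∨ ∃ y ∈ D.conf, x = Sum.inr '' y)
    rw [or_comm]
    refine or_congr (exists_congr fun y => and_congr_right fun _ => ?_)
      (exists_congr fun y => and_congr_right fun _ => ?_)
    · rw [← hl]; exact hinj.eq_iff
    · rw [← hr]; exact hinj.eq_iff
  · rw [Lab.rename_one]
    cases e <;> rfl

theorem restrict (f : C.Ev ≃ D.Ev) (hf : ∀ x, f '' x ∈ D.conf ↔ x ∈ C.conf)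
    {F : Set C.Ev} {G : Set D.Ev} (hFG : ∀ e, e ∈ F ↔ f e ∈ G) (x : Set F) :
    (f.subtypeEquiv hFG '' x) ∈ (D.restrict G).conf ↔ x ∈ (C.restrict F).conf := by
  have : Subtype.val '' (f.subtypeEquiv hFG '' x) = f '' (Subtype.val '' x) := by
    simp only [Set.image_image]
    rfl
  change _ ∈ D.conf ↔ _ ∈ C.conf
  rw [← hf]
  exact Iff.of_eq (congrArg (· ∈ D.conf) this)

theorem restrictName (h : Iso σ C D) (a : N) :
    Iso σ (C.restrictName a) (D.restrictName (σ a)) := by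
  obtain ⟨f, hf, hl⟩ := h
  refine ⟨f.subtypeEquiv fun e => ?_, restrict f hf _, fun e => hl e.1⟩
  change (_ ≠ _ ∧ _ ≠ _) ↔ (_ ≠ _ ∧ _ ≠ _)
  rw [hl, ne_eq, ne_eq, ne_eq, ne_eq, Lab.rename_eq_name_iff, Lab.rename_eq_coname_iff]

end Iso

theorem some_lab_par {C D : ConfStr N} (e : (C.par D).Ev) :
    some ((C.par D).lab e) = synchronise ((C.prod D).lab e.1) :=
  Option.some_get e.2

open Classical in
-- A permutation of the names is injective and commutes with the complement, so it neither creates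
-- nor destroys complementary pairs.
theorem synchronise_rename (σ : Equiv.Perm N) (x : Lab N) :
    synchronise (x.rename σ) = (synchronise x).map (Lab.rename σ) := by
  rcases x with α | ⟨(l | _) | _, (k | _) | _⟩ <;> try rfl
  change (if k.rename σ = (l.rename σ).bar then some (Lab.act Act.tau) else none) =
    Option.map (Lab.rename σ) (if k = l.bar then some (Lab.act Act.tau) else none)
  rw [Vis.bar_rename, (Vis.rename_injective σ).eq_iff]
  split_ifs <;> rfl

namespace Iso

variable {σ : Equiv.Perm N} {C C' D D' : ConfStr N}

theorem prod_conf (f : C.Ev ≃ D.Ev) (hf : ∀ x, f '' x ∈ D.conf ↔ x ∈ C.conf)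
    (g : C'.Ev ≃ D'.Ev) (hg : ∀ x, g '' x ∈ D'.conf ↔ x ∈ C'.conf)
    {x : Set (StarProd C.Ev C'.Ev)} (hx : x ∈ (C.prod C').conf) :
    pimage (StarProd.pmap (fun a => some (f a)) (fun b => some (g b))) x ∈ (D.prod D').conf := by
  refine pimage_mem_prod_conf ?_ ?_ (fun y hy => ?_) (fun y hy => ?_) hx
  · intro a a' c h h'
    exact f.injective (Option.some_injective _ (h.trans h'.symm))
  · intro a a' c h h'
    exact g.injective (Option.some_injective _ (h.trans h'.symm))
  · rw [pimage_some]; exact (hf y).2 hy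
  · rw [pimage_some]; exact (hg y).2 hy

/-- The bijection between products induced by bijections of the components. -/
def _root_.RevCCS.StarProd.congr {A B A' B' : Type} (f : A ≃ A') (g : B ≃ B') :
    StarProd A B ≃ StarProd A' B' where
  toFun
    | StarProd.left a => StarProd.left (f a)
    | StarProd.right b => StarProd.right (g b)
    | StarProd.both a b => StarProd.both (f a) (g b)
  invFun
    | StarProd.left a => StarProd.left (f.symm a)
    | StarProd.right b => StarProd.right (g.symm b)
    | StarProd.both a b => StarProd.both (f.symm a) (g.symm b)
  left_inv e := by cases e <;> simp
  right_inv e := by cases e <;> simp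

theorem _root_.RevCCS.StarProd.pimage_congr {A B A' B' : Type} (f : A ≃ A') (g : B ≃ B')
    (x : Set (StarProd A B)) :
    pimage (StarProd.pmap (fun a => some (f a)) (fun b => some (g b))) x =
      StarProd.congr f g '' x := by
  rw [← pimage_some]
  congr 1
  funext e
  cases e <;> rfl

theorem par (h : Iso σ C D) (h' : Iso σ C' D') : Iso σ (C.par C') (D.par D') := by
  obtain ⟨f, hf, hl⟩ := h
  obtain ⟨g, hg, hl'⟩ := h'
  have hconf : ∀ x : Set (StarProd C.Ev C'.Ev),
      StarProd.congr f g '' x ∈ (D.prod D').conf ↔ x ∈ (C.prod C').conf := by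
    intro x
    constructor
    · intro hx
      have hf' : ∀ x, f.symm '' x ∈ C.conf ↔ x ∈ D.conf := fun x => by
        rw [← hf, Equiv.image_symm_eq_preimage, Set.image_preimage_eq _ f.surjective]
      have hg' : ∀ x, g.symm '' x ∈ C'.conf ↔ x ∈ D'.conf := fun x => by
        rw [← hg, Equiv.image_symm_eq_preimage, Set.image_preimage_eq _ g.surjective]
      have := prod_conf f.symm hf' g.symm hg' hx
      rw [StarProd.pimage_congr] at this
      change (StarProd.congr f g).symm '' _ ∈ _ at this
      rwa [Equiv.image_symm_eq_preimage,
        Set.preimage_image_eq _ (StarProd.congr f g).injective] at this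
    · intro hx
      rw [← StarProd.pimage_congr]
      exact prod_conf f hf g hg hx
  have hlab : ∀ e, (D.prod D').lab (StarProd.congr f g e) = ((C.prod C').lab e).rename σ := by
    intro e
    cases e with
    | left a => exact hl a
    | right b => exact hl' b
    | both a b => exact congrArg₂ Lab.pair (hl a) (hl' b)
  have hmem : ∀ e : StarProd C.Ev C'.Ev, (synchronise ((C.prod C').lab e)).isSome ↔
      (synchronise ((D.prod D').lab (StarProd.congr f g e))).isSome := fun e => by
    rw [hlab, synchronise_rename, Option.isSome_map]
  refine ⟨(StarProd.congr f g).subtypeEquiv hmem,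
    restrict (C := C.prod C') (D := D.prod D') (StarProd.congr f g) hconf _, fun e => ?_⟩
  · apply Option.some_injective
    have h₁ : some ((D.par D').lab ((StarProd.congr f g).subtypeEquiv hmem e)) =
      synchronise ((D.prod D').lab (StarProd.congr f g e.1)) := some_lab_par (C := D) _
    exact h₁.trans ((congrArg synchronise (hlab e.1)).trans ((synchronise_rename σ _).trans
      (congrArg (Option.map (Lab.rename σ)) (some_lab_par e).symm)))

end Iso

end ConfStr

/-! ### Restriction commutes with prefixing and coproducts -/

namespace ConfStr

/-- The action `α` is not `a` or its complement. -/
def _root_.RevCCS.Act.Avoids (α : Act N) (a : N) : Prop :=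
  α ≠ Act.vis (Vis.name a) ∧ α ≠ Act.vis (Vis.coname a)

theorem _root_.RevCCS.Vis.avoids_iff (l : Vis N) (a : N) :
    (Act.vis l).Avoids a ↔ l.base ≠ a := by
  rw [Vis.base_ne_iff]
  simp [Act.Avoids]

/-- Since `l` is not over `a`, the least event of the prefix survives the restriction. -/
theorem iso_guarded_restrictName (C : ConfStr N) {l : Vis N} {a : N} (h : l.base ≠ a) :
    Iso 1 (guarded l (C.restrictName a)) ((guarded l C).restrictName a) := by
  have hl := (Vis.base_ne_iff l a).1 h
  let f : (guarded l (C.restrictName a)).Ev → ((guarded l C).restrictName a).Ev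
    | none => ⟨none, by
        change Lab.act (Act.vis l) ≠ _ ∧ Lab.act (Act.vis l) ≠ _
        simpa using hl⟩
    | some e => ⟨some e.1, e.2⟩
  have hf : Function.Bijective f := by
    constructor
    · rintro (_ | e) (_ | e') h
      · rfl
      · cases congrArg Subtype.val h
      · cases congrArg Subtype.val h
      · exact congrArg some (Subtype.ext (Option.some_injective _ (congrArg Subtype.val h)))
    · rintro ⟨_ | e, he⟩
      · exact ⟨none, rfl⟩
      · exact ⟨some ⟨e, he⟩, rfl⟩
  refine ⟨Equiv.ofBijective f hf, fun x => ?_, fun e => ?_⟩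
  · change Set (Option (C.restrictName a).Ev) at x
    change Set.image (Subtype.val : _ → Option C.Ev) (f '' x) ∈ (guarded l C).conf ↔ _
    have himg : Set.image (Subtype.val : _ → Option C.Ev) (f '' x) = Option.map Subtype.val '' x :=
      (Set.image_image Subtype.val f x).trans (Set.image_congr fun e _ => by cases e <;> rfl)
    refine (Iff.of_eq (congrArg (· ∈ (guarded l C).conf) himg)).trans ?_
    change (Option.map Subtype.val '' x = (∅ : Set (Option C.Ev)) ∨
      ∃ y ∈ C.conf, Option.map Subtype.val '' x = insert none (some '' y)) ↔
      (x = ∅ ∨ ∃ y : Set (C.restrictName a).Ev, Subtype.val '' y ∈ C.conf ∧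
        x = insert none (some '' y))
    refine or_congr Set.image_eq_empty ⟨?_, ?_⟩
    · rintro ⟨y, hy, hxy⟩
      obtain ⟨z, rfl⟩ := exists_eq_image_val (F := {e | C.lab e ≠ Lab.act (Act.vis (Vis.name a)) ∧
        C.lab e ≠ Lab.act (Act.vis (Vis.coname a))}) (y := y) (by
          intro c hc
          have : some c ∈ Option.map Subtype.val '' x := by
            rw [hxy]
            exact Or.inr ⟨c, hc, rfl⟩
          obtain ⟨_ | e, -, he⟩ := this
          · cases he
          · obtain rfl := Option.some_injective _ he
            exact e.2)
      refine ⟨z, hy, ?_⟩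
      exact Set.image_injective.2 (Option.map_injective Subtype.val_injective)
        (hxy.trans (image_map_insert_none Subtype.val z).symm)
    · rintro ⟨y, hy, rfl⟩
      exact ⟨_, hy, image_map_insert_none Subtype.val y⟩
  · rw [Lab.rename_one]
    cases e <;> rfl

theorem iso_coprod_restrictName (C D : ConfStr N) {a : N}
    (h : ∀ e, D.lab e ≠ Lab.act (Act.vis (Vis.name a)) ∧
      D.lab e ≠ Lab.act (Act.vis (Vis.coname a))) :
    Iso 1 ((C.restrictName a).coprod D) ((C.coprod D).restrictName a) := by
  let f : ((C.restrictName a).coprod D).Ev → ((C.coprod D).restrictName a).Ev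
    | Sum.inl e => ⟨Sum.inl e.1, e.2⟩
    | Sum.inr e => ⟨Sum.inr e, h e⟩
  have hf : Function.Bijective f := by
    constructor
    · rintro (e | e) (e' | e') h
      · exact congrArg Sum.inl (Subtype.ext (Sum.inl_injective (congrArg Subtype.val h)))
      · cases congrArg Subtype.val h
      · cases congrArg Subtype.val h
      · exact congrArg Sum.inr (Sum.inr_injective (congrArg Subtype.val h))
    · rintro ⟨e | e, he⟩
      · exact ⟨Sum.inl ⟨e, he⟩, rfl⟩
      · exact ⟨Sum.inr e, rfl⟩
  refine ⟨Equiv.ofBijective f hf, fun x => ?_, fun e => ?_⟩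
  · change Set ((C.restrictName a).Ev ⊕ D.Ev) at x
    change Set.image (Subtype.val : _ → C.Ev ⊕ D.Ev) (f '' x) ∈ (C.coprod D).conf ↔ _
    have himg : Set.image (Subtype.val : _ → C.Ev ⊕ D.Ev) (f '' x) = Sum.map Subtype.val id '' x :=
      (Set.image_image Subtype.val f x).trans (Set.image_congr fun e _ => by cases e <;> rfl)
    refine (Iff.of_eq (congrArg (· ∈ (C.coprod D).conf) himg)).trans ?_
    change ((∃ y ∈ C.conf, Sum.map Subtype.val id '' x = Sum.inl '' y) ∨
      ∃ y ∈ D.conf, Sum.map Subtype.val id '' x = (Sum.inr '' y : Set (C.Ev ⊕ D.Ev))) ↔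
      ((∃ y : Set (C.restrictName a).Ev, Subtype.val '' y ∈ C.conf ∧ x = Sum.inl '' y) ∨
        ∃ y ∈ D.conf, x = Sum.inr '' y)
    have hinj : Function.Injective (Set.image (Sum.map Subtype.val id :
        (C.restrictName a).Ev ⊕ D.Ev → C.Ev ⊕ D.Ev)) :=
      Set.image_injective.2 (Subtype.val_injective.sumMap Function.injective_id)
    refine or_congr ⟨?_, ?_⟩ (exists_congr fun y => and_congr_right fun _ => ?_)
    · rintro ⟨y, hy, hxy⟩
      obtain ⟨z, rfl⟩ := exists_eq_image_val (F := {e | C.lab e ≠ Lab.act (Act.vis (Vis.name a)) ∧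
        C.lab e ≠ Lab.act (Act.vis (Vis.coname a))}) (y := y) (by
          intro c hc
          have : Sum.inl c ∈ Sum.map Subtype.val id '' x := by
            rw [hxy]
            exact ⟨c, hc, rfl⟩
          obtain ⟨e | e, -, he⟩ := this
          · obtain rfl := Sum.inl_injective he
            exact e.2
          · cases he)
      refine ⟨z, hy, ?_⟩
      exact hinj (hxy.trans (image_sumMap_inl Subtype.val id z).symm)
    · rintro ⟨y, hy, rfl⟩
      exact ⟨_, hy, image_sumMap_inl Subtype.val id y⟩
    · have hinr := image_sumMap_inr (Subtype.val : (C.restrictName a).Ev → C.Ev) id y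
      rw [Set.image_id] at hinr
      exact ⟨fun h => hinj (h.trans hinr.symm), fun h => h ▸ hinr⟩
  · rw [Lab.rename_one]
    cases e <;> rfl

end ConfStr

/-! ### CCS processes up to isomorphism of their encodings -/

namespace CCS

open ConfStr

theorem synchronise_eq_some {x y : Lab N} (h : synchronise x = some y) :
    (∃ α, x = Lab.act α ∧ y = Lab.act α) ∨ y = Lab.act Act.tau := by
  rcases x with α | ⟨(_ | _) | _, (_ | _) | _⟩ <;> simp only [synchronise] at h <;>
    simp_all [eq_comm]

/-- The labels of an encoding are `τ` or labels over free names. -/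
theorem exists_lab_enc (P : CCS N) (e : P.enc.Ev) :
    ∃ α : Act N, P.enc.lab e = Lab.act α ∧ ∀ a ∉ P.freeNames, α.Avoids a := by
  induction P with
  | nil => exact e.elim
  | pre l P ih =>
    cases e with
    | none =>
      refine ⟨Act.vis l, rfl, fun a ha => ?_⟩
      rw [Vis.avoids_iff]
      rintro rfl
      exact ha (Or.inl rfl)
    | some e =>
      obtain ⟨α, hα, hn⟩ := ih e
      exact ⟨α, hα, fun a ha => hn a fun h => ha (Or.inr h)⟩
  | par P Q ihP ihQ =>
    have he := some_lab_par e
    rcases synchronise_eq_some he.symm with ⟨α, hα, hα'⟩ | hτ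
    · refine ⟨α, hα', ?_⟩
      obtain ⟨e | e | ⟨e, e'⟩, he'⟩ := e
      · obtain ⟨β, hβ, hn⟩ := ihP e
        obtain rfl : β = α := Lab.act.inj (hβ.symm.trans hα)
        exact fun a ha => hn a fun h => ha (Or.inl h)
      · obtain ⟨β, hβ, hn⟩ := ihQ e
        obtain rfl : β = α := Lab.act.inj (hβ.symm.trans hα)
        exact fun a ha => hn a fun h => ha (Or.inr h)
      · cases hα
    · exact ⟨Act.tau, hτ, fun a _ => by simp [Act.Avoids]⟩
  | sum l P k Q ihP ihQ =>
    rcases e with (_ | e) | (_ | e)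
    · refine ⟨Act.vis l, rfl, fun a ha => ?_⟩
      rw [Vis.avoids_iff]
      rintro rfl
      exact ha (Or.inl (Or.inl rfl))
    · obtain ⟨α, hα, hn⟩ := ihP e
      exact ⟨α, hα, fun a ha => hn a fun h => ha (Or.inl (Or.inr h))⟩
    · refine ⟨Act.vis k, rfl, fun a ha => ?_⟩
      rw [Vis.avoids_iff]
      rintro rfl
      exact ha (Or.inr (Or.inl rfl))
    · obtain ⟨α, hα, hn⟩ := ihQ e
      exact ⟨α, hα, fun a ha => hn a fun h => ha (Or.inr (Or.inr h))⟩
  | res P b ih =>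
    obtain ⟨α, hα, hn⟩ := ih e.1
    refine ⟨α, hα, fun a ha => ?_⟩
    by_cases h : a ∈ P.freeNames
    · obtain rfl : a = b := by
        by_contra hab
        exact ha ⟨h, hab⟩
      have h₁ := e.2
      change P.enc.lab e.1 ≠ _ ∧ P.enc.lab e.1 ≠ _ at h₁
      rw [hα] at h₁
      simpa [Act.Avoids] using h₁
    · exact hn a h

theorem lab_enc_ne (P : CCS N) {a : N} (ha : a ∉ P.freeNames) (e : P.enc.Ev) :
    P.enc.lab e ≠ Lab.act (Act.vis (Vis.name a)) ∧
      P.enc.lab e ≠ Lab.act (Act.vis (Vis.coname a)) := by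
  obtain ⟨α, hα, hn⟩ := P.exists_lab_enc e
  rw [hα]
  simpa [Act.Avoids] using hn a ha

/-- This serves the configurations of a memory after which no event of the process has yet occurred.
-/
theorem empty_mem_enc_conf (P : CCS N) : ∅ ∈ P.enc.conf := by
  induction P with
  | nil => exact rfl
  | pre l P ih => exact Or.inl rfl
  | par P Q ihP ihQ =>
    have h₁ : StarProd.proj₁ (∅ : Set (StarProd P.enc.Ev Q.enc.Ev)) = ∅ := by
      simp [StarProd.proj₁]
    have h₂ : StarProd.proj₂ (∅ : Set (StarProd P.enc.Ev Q.enc.Ev)) = ∅ := by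
      simp [StarProd.proj₂]
    have h : (∅ : Set (StarProd P.enc.Ev Q.enc.Ev)) ∈ (P.enc.prod Q.enc).conf :=
      ⟨⟨h₁ ▸ ihP, h₂ ▸ ihQ⟩, fun _ h => h.elim, fun _ h => h.elim, fun _ h => h.elim⟩
    change Subtype.val '' ∅ ∈ (P.enc.prod Q.enc).conf
    rwa [Set.image_empty]
  | sum l P k Q ihP ihQ => exact Or.inl ⟨∅, Or.inl rfl, (Set.image_empty _).symm⟩
  | res P a ih =>
    change Subtype.val '' ∅ ∈ P.enc.conf
    rwa [Set.image_empty]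

theorem enc_rename (σ : Equiv.Perm N) (P : CCS N) : Iso σ P.enc (P.rename σ).enc := by
  induction P with
  | nil =>
    exact ⟨Equiv.refl _, fun x => Iff.of_eq (congrArg (· ∈ ConfStr.zero.conf) (Set.image_id x)),
      fun e => e.elim⟩
  | pre l P ih => exact ih.guarded l
  | par P Q ihP ihQ => exact ihP.par ihQ
  | sum l P k Q ihP ihQ => exact (ihP.guarded l).coprod (ihQ.guarded k)
  | res P a ih => exact ih.restrictName a

/-- Processes with isomorphic encodings. -/
def Equivalent (P Q : CCS N) : Prop :=
  Iso 1 P.enc Q.enc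

namespace Equivalent

variable {P P' Q Q' S : CCS N}

theorem refl (P : CCS N) : Equivalent P P := Iso.refl _

theorem symm (h : Equivalent P Q) : Equivalent Q P := Iso.symm h

theorem trans (h : Equivalent P Q) (h' : Equivalent Q S) : Equivalent P S := Iso.trans h h'

theorem pre (l : Vis N) (h : Equivalent P P') : Equivalent (CCS.pre l P) (CCS.pre l P') := by
  have := Iso.guarded h l
  rwa [Vis.rename_one] at this

theorem par (h : Equivalent P P') (h' : Equivalent Q Q') :
    Equivalent (CCS.par P Q) (CCS.par P' Q') :=
  Iso.par h h'

theorem sum (l k : Vis N) (h : Equivalent P P') (h' : Equivalent Q Q') :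
    Equivalent (CCS.sum l P k Q) (CCS.sum l P' k Q') :=
  Iso.coprod (h.pre l) (h'.pre k)

theorem res (a : N) (h : Equivalent P P') : Equivalent (CCS.res P a) (CCS.res P' a) :=
  Iso.restrictName h a

theorem sum_comm (l : Vis N) (P : CCS N) (k : Vis N) (Q : CCS N) :
    Equivalent (CCS.sum l P k Q) (CCS.sum k Q l P) :=
  Iso.coprod_comm _ _

open Classical in
-- The transposition renames the labels, but labels over `a` are removed by the restriction and
-- labels over `b` do not occur, so the remaining ones are all fixed.
theorem conv (P : CCS N) {a b : N} (hb : b ∉ P.freeNames) :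
    Equivalent (CCS.res P a) (CCS.res (P.rename (Equiv.swap a b)) b) := by
  have h := (enc_rename (Equiv.swap a b) P).restrictName a
  rw [Equiv.swap_apply_left] at h
  refine h.of_fixed fun e => ?_
  change (P.enc.lab e.1).rename _ = P.enc.lab e.1
  have ha := e.2
  change P.enc.lab e.1 ≠ _ ∧ P.enc.lab e.1 ≠ _ at ha
  have hb' := P.lab_enc_ne hb e.1
  obtain ⟨α, hα, -⟩ := P.exists_lab_enc e.1
  rw [hα] at ha hb' ⊢
  rcases α with (c | c) | _
  · rw [Lab.rename, Act.rename, Vis.rename, Equiv.swap_apply_of_ne_of_ne] <;> rintro rfl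
    exacts [ha.1 rfl, hb'.1 rfl]
  · rw [Lab.rename, Act.rename, Vis.rename, Equiv.swap_apply_of_ne_of_ne] <;> rintro rfl
    exacts [ha.2 rfl, hb'.2 rfl]
  · rfl

theorem of_alphaEq (h : AlphaEq P Q) : Equivalent P Q := by
  induction h with
  | refl P => exact refl P
  | symm _ ih => exact ih.symm
  | trans _ _ ih ih' => exact ih.trans ih'
  | pre l _ ih => exact ih.pre l
  | par _ _ ih ih' => exact ih.par ih'
  | sum l k _ _ ih ih' => exact ih.sum l k ih'
  | res a _ ih => exact ih.res a
  | conv P a b hb => exact conv P hb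

end Equivalent

namespace IsSum

variable {P P' Q S S' : CCS N} {l : Vis N} {a : N}

theorem exists_of_isSum (h : IsSum S l P Q) (P' : CCS N) : ∃ S', IsSum S' l P' Q := by
  cases h with
  | single => exact ⟨_, single _ _⟩
  | left => exact ⟨_, left _ _ _ _⟩
  | right => exact ⟨_, left _ _ _ _⟩

/-- `IsSum` determines the sum up to the order of its two branches, which the encoding does not see
up to isomorphism. -/
theorem equivalent (h : IsSum S l P Q) (h' : IsSum S' l P' Q) (hP : Equivalent P P') :
    Equivalent S S' := by
  cases h with
  | single =>
    cases h'
    exact hP.pre l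
  | left l P k Q =>
    cases h' with
    | left => exact hP.sum l k (Equivalent.refl Q)
    | right => exact (hP.sum l k (Equivalent.refl Q)).trans (Equivalent.sum_comm _ _ _ _)
  | right k Q l P =>
    cases h' with
    | left => exact (Equivalent.sum_comm _ _ _ _).trans (hP.sum l k (Equivalent.refl Q))
    | right => exact (Equivalent.refl Q).sum k l hP

/-- A restriction can be moved under a prefix if its name does not occur elsewhere in the sum. -/
theorem equivalent_res (h : IsSum S l (CCS.res P a) Q) (h' : IsSum S' l P Q) (hl : l.base ≠ a)
    (hQ : a ∉ Q.freeNames) : Equivalent S (CCS.res S' a) := by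
  have key : ∀ k Q, a ∉ (pre k Q).freeNames →
      Equivalent (CCS.sum l (CCS.res P a) k Q) (CCS.res (CCS.sum l P k Q) a) := fun k Q ha =>
    ((iso_guarded_restrictName P.enc hl).coprod (Iso.refl (guarded k Q.enc))).trans
      (iso_coprod_restrictName (guarded l P.enc) (guarded k Q.enc) ((pre k Q).lab_enc_ne ha))
  cases h with
  | single =>
    cases h'
    exact iso_guarded_restrictName P.enc hl
  | left l _ k Q =>
    cases h' with
    | left => exact key k Q hQ
    | right => exact (key k Q hQ).trans ((Equivalent.sum_comm _ _ _ _).res a)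
  | right k Q l _ =>
    refine (Equivalent.sum_comm _ _ _ _).trans ?_
    cases h' with
    | left => exact key k Q hQ
    | right => exact (key k Q hQ).trans ((Equivalent.sum_comm _ _ _ _).res a)

theorem included (h : IsSum S l P Q) : (guarded l P.enc).Included S.enc := by
  cases h with
  | single => exact (Iso.refl _).included
  | left l P k Q =>
    exact ⟨Sum.inl, Sum.inl_injective, fun x hx => Or.inl ⟨x, hx, rfl⟩, fun _ => rfl⟩
  | right k Q l P =>
    exact ⟨Sum.inr, Sum.inr_injective, fun x hx => Or.inr ⟨x, hx, rfl⟩, fun _ => rfl⟩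

end IsSum

end CCS

/-! ### The actions recorded in a process -/

namespace Mem

open Classical in
/-- The action recorded in a memory for an identifier. -/
noncomputable def label : Mem N → ℕ → Option (Act N)
  | empty => fun _ => none
  | fork m => m.label
  | event i l _ m => Function.update m.label i (some (Act.vis l))

theorem label_eq_none_iff (m : Mem N) (i : ℕ) : m.label i = none ↔ i ∉ m.ids := by
  induction m with
  | empty => simp [label, ids]
  | fork m ih => exact ih
  | event j l P m ih =>
    by_cases h : i = j
    · subst h
      simp [label, ids]
    · simp [label, ids, h, ih]

theorem avoids_of_label (m : Mem N) {a : N} (ha : a ∉ m.freeNames) {i : ℕ} {α : Act N}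
    (h : m.label i = some α) : α.Avoids a := by
  induction m with
  | empty => cases h
  | fork m ih => exact ih ha h
  | event j l P m ih =>
    by_cases hij : i = j
    · subst hij
      simp only [label, Function.update_self, Option.some.injEq] at h
      rw [← h, Vis.avoids_iff]
      rintro rfl
      exact ha (Or.inl (Or.inl rfl))
    · rw [label, Function.update_of_ne hij] at h
      exact ih (fun h' => ha (Or.inr h')) h

end Mem

open Classical in
/-- The action of an identifier in a parallel composition: equal actions come from a fork, different
ones from a synchronisation. -/
noncomputable def mergeAct : Option (Act N) → Option (Act N) → Option (Act N)
  | none, o => o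
  | some α, none => some α
  | some α, some β => if α = β then some α else some Act.tau

@[simp]
theorem mergeAct_none_left (o : Option (Act N)) : mergeAct none o = o := by
  cases o <;> rfl

@[simp]
theorem mergeAct_none_right (o : Option (Act N)) : mergeAct o none = o := by
  cases o <;> rfl

@[simp]
theorem mergeAct_self (o : Option (Act N)) : mergeAct o o = o := by
  cases o <;> simp [mergeAct]

theorem mergeAct_eq_none_iff (o o' : Option (Act N)) :
    mergeAct o o' = none ↔ o = none ∧ o' = none := by
  cases o <;> cases o' <;> simp [mergeAct]
  split_ifs <;> simp

theorem mergeAct_bar (l : Vis N) :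
    mergeAct (some (Act.vis l)) (some (Act.vis l.bar)) = some Act.tau := by
  simp [mergeAct, l.bar_ne.symm]

namespace RCCS

/-- The action recorded in a process for an identifier. -/
noncomputable def label : RCCS N → ℕ → Option (Act N)
  | thread m _ => m.label
  | par R S => fun i => mergeAct (R.label i) (S.label i)
  | res R _ => R.label

theorem label_eq_none_iff (R : RCCS N) (i : ℕ) : R.label i = none ↔ i ∉ R.ids := by
  induction R with
  | thread m P => exact m.label_eq_none_iff i
  | par R S ihR ihS => simp [label, ids, mergeAct_eq_none_iff, ihR, ihS]
  | res R a ih => exact ih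

/-- Recording actions by identifier makes them insensitive to the shape of the process: distributing
a memory over a fork duplicates its events, but `mergeAct` is idempotent. -/
theorem Congr.label_eq {R S : RCCS N} (h : Congr R S) : R.label = S.label := by
  induction h with
  | refl R => rfl
  | symm _ ih => exact ih.symm
  | trans _ _ ih ih' => exact ih.trans ih'
  | par _ _ ih ih' => simp only [label, ih, ih']
  | res a _ ih => exact ih
  | distribution m P Q => funext i; simp [label, Mem.label]
  | scope m P a _ => rfl
  | alpha m _ => rfl

/-- The backward rules mirror the forward ones, so backward steps can be studied as forward steps
read from target to source. -/
theorem Step.reverse {d : Dir} {i : ℕ} {α : Act N} {R R' : RCCS N} (h : Step d i α R R')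
    (hd : d = Dir.backward) : Step Dir.forward i α R' R := by
  induction h with
  | act => cases hd
  | actBack hs hi => exact Step.act hs hi
  | syn _ _ ih ih' => exact Step.syn (ih hd) (ih' hd)
  | parLeft _ hi ih => exact Step.parLeft (ih hd) hi
  | parRight _ hi ih => exact Step.parRight (ih hd) hi
  | res _ h h' ih => exact Step.res (ih hd) h h'
  | congr hc _ hc' ih => exact Step.congr hc'.symm (ih hd) hc.symm

open Classical in
-- In a synchronisation both components record the new identifier, with labels `l` and `l.bar`;
-- these differ, so they merge to `τ`.
theorem Step.label_eq {d : Dir} {i : ℕ} {α : Act N} {R R' : RCCS N} (h : Step d i α R R')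
    (hd : d = Dir.forward) :
    R.label i = none ∧ R'.label = Function.update R.label i (some α) := by
  induction h with
  | act hs hi => exact ⟨(Mem.label_eq_none_iff _ _).2 hi, rfl⟩
  | actBack => cases hd
  | @syn d i l _ _ _ _ _ _ ih ih' =>
    obtain ⟨h₁, h₂⟩ := ih hd
    obtain ⟨h₃, h₄⟩ := ih' hd
    refine ⟨by simp [label, h₁, h₃], funext fun j => ?_⟩
    by_cases hj : j = i
    · subst hj
      simp [label, h₂, h₄, mergeAct_bar]
    · simp [label, h₂, h₄, hj]
  | @parLeft d i α R R' S _ hi ih =>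
    obtain ⟨h₁, h₂⟩ := ih hd
    rw [← label_eq_none_iff] at hi
    refine ⟨by simp [label, h₁, hi], funext fun j => ?_⟩
    by_cases hj : j = i
    · subst hj
      simp [label, h₂, hi]
    · simp [label, h₂, hj]
  | @parRight d i α R S S' _ hi ih =>
    obtain ⟨h₁, h₂⟩ := ih hd
    rw [← label_eq_none_iff] at hi
    refine ⟨by simp [label, h₁, hi], funext fun j => ?_⟩
    by_cases hj : j = i
    · subst hj
      simp [label, h₂, hi]
    · simp [label, h₂, hj]
  | res _ _ _ ih => exact ih hd
  | congr hc _ hc' ih => rw [hc.label_eq, ← hc'.label_eq]; exact ih hd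

theorem Step.label_of_label {i : ℕ} {α : Act N} {R R' : RCCS N}
    (h : Step Dir.forward i α R R') {j : ℕ} {β : Act N} (hj : R.label j = some β) :
    R'.label j = some β := by
  obtain ⟨h₁, h₂⟩ := h.label_eq rfl
  rw [h₂, Function.update_of_ne _ _ _, hj]
  rintro rfl
  rw [h₁] at hj
  cases hj

theorem Step.label_or_eq {i : ℕ} {α : Act N} {R R' : RCCS N}
    (h : Step Dir.forward i α R R') {j : ℕ} {β : Act N} (hj : R'.label j = some β) :
    R.label j = some β ∨ (j = i ∧ β = α) := by
  classical
  rw [(h.label_eq rfl).2] at hj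
  by_cases hji : j = i
  · subst hji
    rw [Function.update_self] at hj
    exact Or.inr ⟨rfl, (Option.some_injective _ hj).symm⟩
  · rw [Function.update_of_ne hji] at hj
    exact Or.inl hj

/-! ### Rolling back to a thread -/

/-- Outside the base memory `m`, the shared identifiers of `R` and `S` are those of
synchronisations. -/
def Synchronised (m : Mem N) (R S : RCCS N) : Prop :=
  ∀ i ∉ m.ids, ∀ α β, R.label i = some α → S.label i = some β →
    ∃ l : Vis N, α = Act.vis l ∧ β = Act.vis l.bar

/-- No action of `R` is `a` or its complement. -/
def Avoids (R : RCCS N) (a : N) : Prop :=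
  ∀ i α, R.label i = some α → α.Avoids a

open CCS (IsSum Equivalent)

/-- `Rollback m P R`: up to equivalence, undoing the events of `R` outside `m` leads to the thread
`m ▷ P`. -/
inductive Rollback : Mem N → CCS N → RCCS N → Prop
  | thread (m : Mem N) (P : CCS N) : Rollback m P (thread m P)
  | undo {i : ℕ} {l : Vis N} {m : Mem N} {S P Q : CCS N} {R : RCCS N} :
      Rollback (Mem.event i l Q m) P R → IsSum S l P Q → i ∉ m.ids → Rollback m S R
  | par {m : Mem N} {P Q : CCS N} {R S : RCCS N} :
      Rollback m.fork P R → Rollback m.fork Q S → Synchronised m R S →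
      Rollback m (CCS.par P Q) (par R S)
  | res {m : Mem N} {P : CCS N} {R : RCCS N} {a : N} :
      Rollback m P R → a ∉ m.freeNames → R.Avoids a → Rollback m (CCS.res P a) (res R a)
  | equiv {m : Mem N} {P P' : CCS N} {R : RCCS N} :
      Rollback m P R → Equivalent P P' → Rollback m P' R

/-! ### Stability of rollbacks under congruence and transitions -/

namespace Rollback

variable {m m₀ : Mem N} {P P₀ Q₀ : CCS N} {R R' S S' : RCCS N} {a : N}

/-- A property of memories and processes closed under undoing and equivalence. -/
structure Closed (K : Mem N → CCS N → Prop) : Prop where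
  undo {i : ℕ} {l : Vis N} {m : Mem N} {S P Q : CCS N} :
    K (Mem.event i l Q m) P → IsSum S l P Q → i ∉ m.ids → K m S
  equiv {m : Mem N} {P P' : CCS N} : K m P → Equivalent P P' → K m P'

theorem closed (R : RCCS N) : Closed fun m P => Rollback m P R :=
  ⟨undo, equiv⟩

/-- The constructors `undo` and `equiv` keep the third argument of `Rollback`, so its shape fixes
the constructor at which a derivation starts, and the rest of the derivation is covered by `Closed`.
-/
theorem thread_induction {K : Mem N → CCS N → Prop} (hK : Closed K) (h₀ : K m₀ P₀)
    (h : Rollback m P (RCCS.thread m₀ P₀)) : K m P := by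
  generalize hT : RCCS.thread m₀ P₀ = T at h
  induction h with
  | thread m P => cases hT; exact h₀
  | undo _ hs hi ih => exact hK.undo (ih hT) hs hi
  | par => cases hT
  | res => cases hT
  | equiv _ he ih => exact hK.equiv (ih hT) he

theorem par_induction {K : Mem N → CCS N → Prop} (hK : Closed K)
    (h₀ : ∀ m P Q, Rollback m.fork P R → Rollback m.fork Q S → Synchronised m R S →
      K m (CCS.par P Q))
    (h : Rollback m P (RCCS.par R S)) : K m P := by
  generalize hT : RCCS.par R S = T at h
  induction h with
  | thread m P => cases hT
  | undo _ hs hi ih => exact hK.undo (ih hT) hs hi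
  | par h₁ h₂ h₃ => cases hT; exact h₀ _ _ _ h₁ h₂ h₃
  | res => cases hT
  | equiv _ he ih => exact hK.equiv (ih hT) he

theorem res_induction {K : Mem N → CCS N → Prop} (hK : Closed K)
    (h₀ : ∀ m P, Rollback m P R → a ∉ m.freeNames → R.Avoids a → K m (CCS.res P a))
    (h : Rollback m P (RCCS.res R a)) : K m P := by
  generalize hT : RCCS.res R a = T at h
  induction h with
  | thread m P => cases hT
  | undo _ hs hi ih => exact hK.undo (ih hT) hs hi
  | par => cases hT
  | res h₁ h₂ h₃ => cases hT; exact h₀ _ _ h₁ h₂ h₃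
  | equiv _ he ih => exact hK.equiv (ih hT) he

/-- A thread is its own base, or its last event can be undone. -/
theorem thread_cases (h : Rollback m P (RCCS.thread m₀ P₀)) :
    (m = m₀ ∧ Equivalent P P₀) ∨
      ∃ i l Q m', m₀ = Mem.event i l Q m' ∧
        ∀ S, IsSum S l P₀ Q → Rollback m P (RCCS.thread m' S) := by
  refine thread_induction (K := fun m P => (m = m₀ ∧ Equivalent P P₀) ∨
      ∃ i l Q m', m₀ = Mem.event i l Q m' ∧
        ∀ S, IsSum S l P₀ Q → Rollback m P (RCCS.thread m' S)) ⟨?_, ?_⟩ ?_ h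
  · rintro i l m S P Q (⟨rfl, he⟩ | ⟨i', l', Q', m', rfl, h₁⟩) hs hi
    · exact Or.inr ⟨i, l, Q, m, rfl, fun S' hs' =>
        equiv (thread m S') (hs'.equivalent hs he.symm)⟩
    · exact Or.inr ⟨i', l', Q', m', rfl, fun S' hs' => undo (h₁ S' hs') hs hi⟩
  · rintro m P P' (⟨rfl, he⟩ | ⟨i', l', Q', m', rfl, h₁⟩) he'
    · exact Or.inl ⟨rfl, he'.symm.trans he⟩
    · exact Or.inr ⟨i', l', Q', m', rfl, fun S' hs' => equiv (h₁ S' hs') he'⟩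
  · exact Or.inl ⟨rfl, Equivalent.refl _⟩

/-- A thread alone cannot undo a fork on top of its memory, so no event has been undone. -/
theorem equivalent_of_fork (h : Rollback m.fork P (RCCS.thread m₀.fork P₀)) :
    m = m₀ ∧ Equivalent P P₀ := by
  rcases h.thread_cases with ⟨h, he⟩ | ⟨_, _, _, _, h, _⟩
  · cases h
    exact ⟨rfl, he⟩
  · cases h

theorem avoids_thread (P : CCS N) (ha : a ∉ m.freeNames) : (RCCS.thread m P).Avoids a :=
  fun _ _ h => m.avoids_of_label ha h

theorem synchronised_thread (P Q : CCS N) :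
    Synchronised m (RCCS.thread m P) (RCCS.thread m Q) := by
  intro i hi α β h _
  rw [← Mem.label_eq_none_iff] at hi
  cases hi.symm.trans h

/-- The restriction is pulled out through the undone prefixes one at a time. This is allowed because
`a` occurs neither in their labels nor in the stored alternatives, all of which belong to `m₀`. -/
theorem res_of_thread (h : Rollback m P (RCCS.thread m₀ P₀)) (ha : a ∉ m₀.freeNames) :
    a ∉ m.freeNames ∧ Rollback m (CCS.res P a) (RCCS.thread m₀ (CCS.res P₀ a)) := by
  refine thread_induction (K := fun m P => a ∉ m.freeNames ∧
    Rollback m (CCS.res P a) (RCCS.thread m₀ (CCS.res P₀ a))) ⟨?_, ?_⟩ ⟨ha, thread _ _⟩ h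
  · rintro i l m S P Q ⟨ha, h⟩ hs hi
    refine ⟨fun h => ha (Or.inr h), ?_⟩
    obtain ⟨S', hs'⟩ := hs.exists_of_isSum (CCS.res P a)
    refine equiv (undo h hs' hi) (hs'.equivalent_res hs ?_ fun h => ha (Or.inl (Or.inr h)))
    rintro rfl
    exact ha (Or.inl (Or.inl rfl))
  · rintro m P P' ⟨ha, h⟩ he
    exact ⟨ha, equiv h (he.res a)⟩

/-- The equivalence is proved as such because `Congr` is closed under symmetry. The side conditions
on labels transfer by `Congr.label_eq`; the delicate directions are gathering a distributed memory
(`equivalent_of_fork`) and moving a restriction into a thread (`res_of_thread`). -/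
theorem congr_iff (h : Congr R R') : ∀ m P, Rollback m P R ↔ Rollback m P R' := by
  induction h with
  | refl R => exact fun _ _ => Iff.rfl
  | symm _ ih => exact fun m P => (ih m P).symm
  | trans _ _ ih ih' => exact fun m P => (ih m P).trans (ih' m P)
  | par h h' ih ih' =>
    refine fun m P => ⟨par_induction (closed _) fun m P Q h₁ h₂ h₃ => ?_,
      par_induction (closed _) fun m P Q h₁ h₂ h₃ => ?_⟩
    · refine par ((ih _ _).1 h₁) ((ih' _ _).1 h₂) ?_
      rwa [Synchronised, ← h.label_eq, ← h'.label_eq]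
    · refine par ((ih _ _).2 h₁) ((ih' _ _).2 h₂) ?_
      rwa [Synchronised, h.label_eq, h'.label_eq]
  | res a h ih =>
    refine fun m P => ⟨res_induction (closed _) fun m P h₁ h₂ h₃ => ?_,
      res_induction (closed _) fun m P h₁ h₂ h₃ => ?_⟩
    · refine res ((ih _ _).1 h₁) h₂ ?_
      rwa [Avoids, ← h.label_eq]
    · refine res ((ih _ _).2 h₁) h₂ ?_
      rwa [Avoids, h.label_eq]
  | distribution m₀ P₀ Q₀ =>
    refine fun m P => ⟨thread_induction (closed _) ?_,
      par_induction (closed _) fun m P Q h₁ h₂ h₃ => ?_⟩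
    · exact par (thread _ _) (thread _ _) (synchronised_thread (m := m₀.fork) P₀ Q₀)
    · obtain ⟨rfl, he⟩ := h₁.equivalent_of_fork
      exact equiv (thread _ _) (he.par h₂.equivalent_of_fork.2).symm
  | scope m₀ P₀ a ha =>
    refine fun m P => ⟨thread_induction (closed _) ?_,
      res_induction (closed _) fun m P h₁ _ _ => (h₁.res_of_thread ha).2⟩
    exact res (thread _ _) ha (avoids_thread _ ha)
  | alpha m₀ h =>
    have he := Equivalent.of_alphaEq h
    exact fun m P => ⟨thread_induction (closed _) (equiv (thread _ _) he.symm),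
      thread_induction (closed _) (equiv (thread _ _) he)⟩

/-- A new event is undone first by `undo`. The side conditions survive since an identifier new on
one side is absent from the other, unless both sides perform it with complementary labels. -/
theorem forward {d : Dir} {i : ℕ} {α : Act N} (h : Step d i α R R') (hd : d = Dir.forward) :
    ∀ m P, Rollback m P R → Rollback m P R' := by
  induction h with
  | act hs hi => exact fun m P => thread_induction (closed _) (undo (thread _ _) hs hi)
  | actBack => cases hd
  | @syn d i l R R' S S' h h' ih ih' =>
    subst hd
    refine fun m P => par_induction (closed _) fun m P Q h₁ h₂ h₃ =>
      par (ih rfl _ _ h₁) (ih' rfl _ _ h₂) fun j hj α β hα hβ => ?_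
    rcases h.label_or_eq hα with hα' | ⟨rfl, rfl⟩
    · rcases h'.label_or_eq hβ with hβ' | ⟨rfl, rfl⟩
      · exact h₃ j hj α β hα' hβ'
      · cases (h.label_eq rfl).1.symm.trans hα'
    · rcases h'.label_or_eq hβ with hβ' | ⟨-, rfl⟩
      · cases (h'.label_eq rfl).1.symm.trans hβ'
      · exact ⟨l, rfl, rfl⟩
  | @parLeft d i α R R' S h hi ih =>
    subst hd
    refine fun m P => par_induction (closed _) fun m P Q h₁ h₂ h₃ =>
      par (ih rfl _ _ h₁) h₂ fun j hj α β hα hβ => ?_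
    rcases h.label_or_eq hα with hα' | ⟨rfl, rfl⟩
    · exact h₃ j hj α β hα' hβ
    · cases ((label_eq_none_iff _ _).2 hi).symm.trans hβ
  | @parRight d i α R S S' h hi ih =>
    subst hd
    refine fun m P => par_induction (closed _) fun m P Q h₁ h₂ h₃ =>
      par h₁ (ih rfl _ _ h₂) fun j hj α β hα hβ => ?_
    rcases h.label_or_eq hβ with hβ' | ⟨rfl, rfl⟩
    · exact h₃ j hj α β hα hβ'
    · cases ((label_eq_none_iff _ _).2 hi).symm.trans hα
  | @res d i α R R' a h hn hc ih =>
    subst hd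
    refine fun m P => res_induction (closed _) fun m P h₁ h₂ h₃ =>
      res (ih rfl _ _ h₁) h₂ fun j β hβ => ?_
    rcases h.label_or_eq hβ with hβ' | ⟨rfl, rfl⟩
    · exact h₃ j β hβ'
    · exact ⟨hn, hc⟩
  | congr hc _ hc' ih =>
    exact fun m P h => (congr_iff hc' m P).1 (ih hd m P ((congr_iff hc m P).1 h))

/-- Either `R` rolls back to `m ▷ P`, or it does after undoing the last event of `m`. -/
def Undone (α : Act N) (R : RCCS N) (m : Mem N) (P : CCS N) : Prop :=
  Rollback m P R ∨ ∃ i l Q m', m = Mem.event i l Q m' ∧ α = Act.vis l ∧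
    ∀ S, IsSum S l P Q → Rollback m' S R

/-- If the event of `m` to be undone next is the one that the step has already undone, the second
alternative becomes the first. -/
theorem closed_undone (α : Act N) (R : RCCS N) : Closed (Undone α R) := by
  refine ⟨?_, ?_⟩
  · rintro i l m S P Q (h | ⟨i', l', Q', m', h, -, h'⟩) hs hi
    · exact Or.inl (undo h hs hi)
    · cases h
      exact Or.inl (h' S hs)
  · rintro m P P' (h | ⟨i', l', Q', m', rfl, rfl, h'⟩) he
    · exact Or.inl (equiv h he)
    · refine Or.inr ⟨i', l', Q', m', rfl, rfl, fun S hs => ?_⟩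
      obtain ⟨S', hs'⟩ := hs.exists_of_isSum P
      exact equiv (h' S' hs') (hs'.equivalent hs he)

theorem Undone.of_fork {α : Act N} (h : Undone α R m.fork P) : Rollback m.fork P R := by
  rcases h with h | ⟨_, _, _, _, h, _⟩
  · exact h
  · cases h

/-- The components of a parallel composition roll back to a memory with a fork on top, so the undone
event cannot belong to their common memory. Only a thread, possibly under restrictions, can lose the
last event of `m`. -/
theorem backward {d : Dir} {i : ℕ} {α : Act N} (h : Step d i α R R') (hd : d = Dir.forward) :
    ∀ m P, Rollback m P R' → Undone α R m P := by
  induction h with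
  | @act i m₀ l S₀ P₀ Q₀ hs hi =>
    intro m P h
    rcases h.thread_cases with ⟨rfl, he⟩ | ⟨_, _, _, _, h, h'⟩
    · exact Or.inr ⟨i, l, Q₀, m₀, rfl, rfl, fun S hs' =>
        equiv (thread _ _) (hs.equivalent hs' he.symm)⟩
    · cases h
      exact Or.inl (h' _ hs)
  | actBack => cases hd
  | @syn d i l R R' S S' h h' ih ih' =>
    subst hd
    exact fun m P => par_induction (closed_undone _ _) fun m P Q h₁ h₂ h₃ =>
      Or.inl (par (ih rfl _ _ h₁).of_fork (ih' rfl _ _ h₂).of_fork fun j hj α β hα hβ =>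
        h₃ j hj α β (h.label_of_label hα) (h'.label_of_label hβ))
  | @parLeft d i α R R' S h hi ih =>
    subst hd
    exact fun m P => par_induction (closed_undone _ _) fun m P Q h₁ h₂ h₃ =>
      Or.inl (par (ih rfl _ _ h₁).of_fork h₂ fun j hj α β hα hβ =>
        h₃ j hj α β (h.label_of_label hα) hβ)
  | @parRight d i α R S S' h hi ih =>
    subst hd
    exact fun m P => par_induction (closed_undone _ _) fun m P Q h₁ h₂ h₃ =>
      Or.inl (par h₁ (ih rfl _ _ h₂).of_fork fun j hj α β hα hβ =>
        h₃ j hj α β hα (h.label_of_label hβ))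
  | @res d i α R R' a h hn hc ih =>
    subst hd
    refine fun m P => res_induction (closed_undone _ _) fun m P h₁ h₂ h₃ => ?_
    have hR : R.Avoids a := fun j β hβ => h₃ j β (h.label_of_label hβ)
    rcases ih rfl _ _ h₁ with h' | ⟨i', l, Q, m', rfl, rfl, h'⟩
    · exact Or.inl (res h' h₂ hR)
    · refine Or.inr ⟨i', l, Q, m', rfl, rfl, fun S hs => ?_⟩
      -- `S` has the restriction below the prefix and `S'` has none; `S` is equivalent to `S'`
      -- restricted to `a`, because `a` does not occur in the event just undone.
      obtain ⟨S', hs'⟩ := hs.exists_of_isSum P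
      exact equiv (res (h' S' hs') (fun h => h₂ (Or.inr h)) hR)
        (hs.equivalent_res hs' ((Vis.avoids_iff l a).1 ⟨hn, hc⟩)
          fun h => h₂ (Or.inl (Or.inr h))).symm
  | congr hc _ hc' ih =>
    intro m P h
    rcases ih hd m P ((congr_iff hc' m P).2 h) with h' | ⟨i', l, Q, m', rfl, rfl, h'⟩
    · exact Or.inl ((congr_iff hc m P).2 h')
    · exact Or.inr ⟨i', l, Q, m', rfl, rfl, fun S hs => (congr_iff hc _ _).2 (h' S hs)⟩

theorem of_isOrigin (h : IsOrigin P R) : Rollback Mem.empty P R := by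
  induction h with
  | refl => exact thread _ _
  | tail _ h ih =>
    obtain ⟨d | d, i, α, h⟩ := h
    · exact forward h rfl _ _ ih
    · rcases backward (h.reverse rfl) rfl _ _ ih with h' | ⟨_, _, _, _, h', _⟩
      · exact h'
      · cases h'

end Rollback

end RCCS

/-! ### Encodings of memories -/

namespace Mem

/-- No identifier occurs twice in a memory. -/
def Nodup : Mem N → Prop
  | empty => True
  | fork m => m.Nodup
  | event i _ _ m => i ∉ m.ids ∧ m.Nodup

theorem ident_mem_ids (m : Mem N) (c : m.enc.underlying.Ev) : m.enc.ident c ∈ m.ids := by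
  induction m with
  | empty => exact c.elim
  | fork m ih => exact ih c
  | event i l P m ih =>
    cases c with
    | none => exact Or.inl rfl
    | some c => exact Or.inr (ih c)

theorem exists_ident_eq (m : Mem N) {i : ℕ} (hi : i ∈ m.ids) : ∃ c, m.enc.ident c = i := by
  induction m with
  | empty => exact hi.elim
  | fork m ih => exact ih hi
  | event j l P m ih =>
    rcases hi with rfl | hi
    · exact ⟨none, rfl⟩
    · obtain ⟨c, hc⟩ := ih hi
      exact ⟨some c, hc⟩

theorem Nodup.ident_injective {m : Mem N} (h : m.Nodup) : Function.Injective m.enc.ident := by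
  induction m with
  | empty => exact fun c => c.elim
  | fork m ih => exact ih h
  | event i l P m ih =>
    rintro (_ | c) (_ | c') hc
    · rfl
    · have hc : i = m.enc.ident c' := hc
      exact (h.1 (hc ▸ m.ident_mem_ids c')).elim
    · have hc : m.enc.ident c = i := hc
      exact (h.1 (hc ▸ m.ident_mem_ids c)).elim
    · exact congrArg some (ih h.2 hc)

theorem Nodup.label_ident {m : Mem N} (h : m.Nodup) (c : m.enc.underlying.Ev) :
    ∃ α, m.enc.underlying.lab c = Lab.act α ∧ m.label (m.enc.ident c) = some α := by
  classical
  induction m with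
  | empty => exact c.elim
  | fork m ih => exact ih h c
  | event i l P m ih =>
    cases c with
    | none => exact ⟨Act.vis l, rfl, Function.update_self ..⟩
    | some c =>
      obtain ⟨α, hα, hα'⟩ := ih h.2 c
      refine ⟨α, hα, (Function.update_of_ne ?_ _ _).trans hα'⟩
      rintro (hi : m.enc.ident c = i)
      exact h.1 (hi ▸ m.ident_mem_ids c)

/-- Each new event sits on top of all earlier ones, so the set of all events is the only maximal
configuration of a memory. -/
theorem univ_mem_conf (m : Mem N) : Set.univ ∈ m.enc.underlying.conf := by
  induction m with
  | empty => exact Set.eq_empty_of_isEmpty (α := Empty) Set.univ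
  | fork m ih => exact ih
  | event i l P m ih =>
    refine Or.inr ⟨Set.univ, ⟨ih, fun y _ h => (Set.univ_subset_iff.1 h).symm⟩, ?_⟩
    refine (Set.eq_univ_iff_forall.2 ?_).symm
    rintro (_ | c)
    · exact Or.inl rfl
    · exact Or.inr ⟨c, trivial, rfl⟩

theorem eq_univ_of_isMaximal (m : Mem N) {y : Set m.enc.underlying.Ev}
    (h : m.enc.underlying.IsMaximal y) : y = Set.univ :=
  h.2 _ m.univ_mem_conf (Set.subset_univ y)

end Mem

/-! ### Events of parallel compositions of identified structures -/

namespace IdConfStr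

variable {D₁ D₂ : IdConfStr N ℕ}

theorem validate_left {a : D₁.underlying.Ev} (h : ∀ b, D₁.ident a ≠ D₂.ident b) :
    validate D₁ D₂ (StarProd.left a) = some (D₁.underlying.lab a) :=
  if_neg fun ⟨b, hb⟩ => h b hb

theorem validate_right {b : D₂.underlying.Ev} (h : ∀ a, D₁.ident a ≠ D₂.ident b) :
    validate D₁ D₂ (StarProd.right b) = some (D₂.underlying.lab b) :=
  if_neg fun ⟨a, ha⟩ => h a ha

theorem ne_of_validate_left {a : D₁.underlying.Ev}
    (h : (validate D₁ D₂ (StarProd.left a)).isSome) (b : D₂.underlying.Ev) :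
    D₁.ident a ≠ D₂.ident b := by
  intro hb
  rw [validate, if_pos ⟨b, hb⟩] at h
  cases h

theorem ne_of_validate_right {b : D₂.underlying.Ev}
    (h : (validate D₁ D₂ (StarProd.right b)).isSome) (a : D₁.underlying.Ev) :
    D₁.ident a ≠ D₂.ident b := by
  intro ha
  rw [validate, if_pos ⟨a, ha⟩] at h
  cases h

theorem eq_of_validate_both {a : D₁.underlying.Ev} {b : D₂.underlying.Ev}
    (h : (validate D₁ D₂ (StarProd.both a b)).isSome) : D₁.ident a = D₂.ident b := by
  by_contra hab
  rw [validate, if_pos hab] at h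
  cases h

theorem isSome_validate_both {a : D₁.underlying.Ev} {b : D₂.underlying.Ev}
    (h : D₁.ident a = D₂.ident b) : (validate D₁ D₂ (StarProd.both a b)).isSome := by
  rw [validate, if_neg (not_not.2 h)]
  split_ifs <;> rfl

theorem validate_both_same {a : D₁.underlying.Ev} {b : D₂.underlying.Ev} {α : Act N}
    (h : D₁.ident a = D₂.ident b) (ha : D₁.underlying.lab a = Lab.act α)
    (hb : D₂.underlying.lab b = Lab.act α) :
    validate D₁ D₂ (StarProd.both a b) = some (Lab.act α) := by
  rw [validate, if_neg (not_not.2 h), if_neg, if_pos ⟨α, ha, hb⟩, ha]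
  -- `validate` tests for complementary labels before equal ones, and no label is its own
  -- complement.
  rintro ⟨l, hl, hl'⟩
  have := hl.symm.trans (ha.trans (hb.symm.trans hl'))
  simp only [Lab.act.injEq, Act.vis.injEq] at this
  exact l.bar_ne this.symm

theorem validate_both_bar {a : D₁.underlying.Ev} {b : D₂.underlying.Ev} {l : Vis N}
    (h : D₁.ident a = D₂.ident b) (ha : D₁.underlying.lab a = Lab.act (Act.vis l))
    (hb : D₂.underlying.lab b = Lab.act (Act.vis l.bar)) :
    validate D₁ D₂ (StarProd.both a b) = some (Lab.act Act.tau) := by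
  rw [validate, if_neg (not_not.2 h), if_pos ⟨l, ha, hb⟩]

theorem some_lab_par (e : (D₁.par D₂).underlying.Ev) :
    some ((D₁.par D₂).underlying.lab e) = validate D₁ D₂ e.1 :=
  Option.some_get e.2

theorem ident_of_fst {e : (D₁.par D₂).underlying.Ev} {a : D₁.underlying.Ev}
    (h : e.1.fst = some a) : (D₁.par D₂).ident e = D₁.ident a := by
  obtain ⟨a' | b' | ⟨a', b'⟩, he⟩ := e
  · obtain rfl := Option.some_injective _ h; rfl
  · cases h
  · obtain rfl := Option.some_injective _ h; rfl

theorem ident_of_snd {e : (D₁.par D₂).underlying.Ev} {b : D₂.underlying.Ev}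
    (h : e.1.snd = some b) : (D₁.par D₂).ident e = D₂.ident b := by
  obtain ⟨a' | b' | ⟨a', b'⟩, he⟩ := e
  · cases h
  · obtain rfl := Option.some_injective _ h; rfl
  · obtain rfl := Option.some_injective _ h
    exact eq_of_validate_both (D₁ := D₁) (D₂ := D₂) he

end IdConfStr

open IdConfStr ConfStr

/-- No identifier is lost in a parallel composition: it survives on a pair if both sides have it and
on an unpaired event otherwise. Hence an event may stay unpaired only if the other process records
nothing for its identifier (`label_eq_none`). -/
theorem RCCS.exists_ident_eq (R : RCCS N) {i : ℕ} (hi : i ∈ R.ids) :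
    ∃ e, R.encMem.ident e = i := by
  induction R with
  | thread m P => exact m.exists_ident_eq hi
  | par R S ihR ihS =>
    by_cases hR : i ∈ R.ids
    · obtain ⟨a, ha⟩ := ihR hR
      by_cases h : ∃ b, R.encMem.ident a = S.encMem.ident b
      · obtain ⟨b, hb⟩ := h
        exact ⟨⟨StarProd.both a b, isSome_validate_both hb⟩, ha⟩
      · rw [not_exists] at h
        exact ⟨⟨StarProd.left a, Option.isSome_iff_exists.2 ⟨_, validate_left h⟩⟩, ha⟩
    · obtain ⟨b, hb⟩ := ihS (hi.resolve_left hR)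
      by_cases h : ∃ a, R.encMem.ident a = S.encMem.ident b
      · obtain ⟨a, ha⟩ := h
        exact ⟨⟨StarProd.both a b, isSome_validate_both ha⟩, ha.trans hb⟩
      · rw [not_exists] at h
        exact ⟨⟨StarProd.right b, Option.isSome_iff_exists.2 ⟨_, validate_right h⟩⟩, hb⟩
  | res R a ih => exact ih hi

theorem RCCS.label_eq_none (R : RCCS N) {i : ℕ} (h : ∀ e, R.encMem.ident e ≠ i) :
    R.label i = none := by
  rw [label_eq_none_iff]
  intro hi
  obtain ⟨e, he⟩ := R.exists_ident_eq hi
  exact h e he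

/-! ### Embedding memories into encodings -/

theorem mem_of_forall_mem_iff {A : Type} {F : Set (Set A)} {x y : Set A} (hy : y ∈ F)
    (h : ∀ c, c ∈ x ↔ c ∈ y) : x ∈ F :=
  Set.ext h ▸ hy

/-- The map `f` embeds the events of `D` into those of the memory `m` followed by those of `C`; a
configuration of `D` becomes one of `m` followed by one of `C`, where the latter is empty unless the
former contains all events. The labels of `D` are actions, given by `L` in terms of identifiers. -/
structure Embeds (m : Mem N) (C : ConfStr N) (D : IdConfStr N ℕ) (L : ℕ → Option (Act N))
    (f : D.underlying.Ev → m.enc.underlying.Ev ⊕ C.Ev) : Prop where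
  injective : Function.Injective f
  surjective : ∀ c, ∃ e, f e = Sum.inl c
  ident_inl {e c} : f e = Sum.inl c → D.ident e = m.enc.ident c
  ident_inr {e c} : f e = Sum.inr c → D.ident e ∉ m.ids
  lab_inl {e c} : f e = Sum.inl c → m.enc.underlying.lab c = D.underlying.lab e
  lab_inr {e c} : f e = Sum.inr c → C.lab c = D.underlying.lab e
  label (e) : ∃ α, D.underlying.lab e = Lab.act α ∧
    L (D.ident e) = some α
  conf_inl {x} : x ∈ D.underlying.conf →
    pimage (fun e => (f e).getLeft?) x ∈ m.enc.underlying.conf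
  conf_inr {x} : x ∈ D.underlying.conf → pimage (fun e => (f e).getRight?) x ∈ C.conf
  conf_or {x} : x ∈ D.underlying.conf →
    (∀ e ∈ x, ∃ c, f e = Sum.inl c) ∨ ∀ c, ∃ e ∈ x, f e = Sum.inl c

namespace Embeds

theorem thread {m : Mem N} (hm : m.Nodup) {C : ConfStr N} (hC : ∅ ∈ C.conf) :
    Embeds m C m.enc m.label Sum.inl where
  injective := Sum.inl_injective
  surjective c := ⟨c, rfl⟩
  ident_inl h := by cases h; rfl
  ident_inr h := by cases h
  lab_inl h := by cases h; rfl
  lab_inr h := by cases h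
  label := hm.label_ident
  conf_inl {x} hx := ((pimage_some id x).trans (Set.image_id x)).symm ▸ hx
  conf_inr {x} hx := mem_of_forall_mem_iff hC fun c =>
    iff_of_false (fun ⟨_, _, h⟩ => by cases h) fun h => h
  conf_or hx := Or.inl fun e _ => ⟨e, rfl⟩

theorem of_included {m : Mem N} {C E : ConfStr N} {D : IdConfStr N ℕ} {L : ℕ → Option (Act N)}
    {f : D.underlying.Ev → m.enc.underlying.Ev ⊕ C.Ev} (h : Embeds m C D L f)
    (hCE : C.Included E) : ∃ g, Embeds m E D L g := by
  obtain ⟨i, hi, hconf, hlab⟩ := hCE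
  have hl : ∀ {e c}, Sum.map id i (f e) = Sum.inl c → f e = Sum.inl c := by
    intro e c hc
    cases hfe : f e with
    | inl c' => rw [hfe] at hc; cases hc; rfl
    | inr c' => rw [hfe] at hc; cases hc
  have hr : ∀ {e d}, Sum.map id i (f e) = Sum.inr d → ∃ c, f e = Sum.inr c ∧ i c = d := by
    intro e c hc
    cases hfe : f e with
    | inl c' => rw [hfe] at hc; cases hc
    | inr c' => rw [hfe] at hc; exact ⟨c', rfl, Sum.inr_injective hc⟩
  refine ⟨fun e => Sum.map id i (f e), (Function.injective_id.sumMap hi).comp h.injective,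
    fun c => ?_, fun hc => h.ident_inl (hl hc), fun hc => ?_, fun hc => h.lab_inl (hl hc),
    fun hc => ?_, h.label, fun {x} hx => ?_, fun {x} hx => ?_, fun {x} hx => ?_⟩
  · obtain ⟨e, he⟩ := h.surjective c
    exact ⟨e, by rw [he]; rfl⟩
  · obtain ⟨c, hc, -⟩ := hr hc
    exact h.ident_inr hc
  · obtain ⟨c, hc', rfl⟩ := hr hc
    rw [hlab, h.lab_inr hc']
  · refine mem_of_forall_mem_iff (h.conf_inl hx) fun c => exists_congr fun e =>
      and_congr_right fun _ => Sum.getLeft?_eq_some_iff.trans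
        (Iff.trans ⟨hl, fun hc => ?_⟩ Sum.getLeft?_eq_some_iff.symm)
    rw [hc]
    rfl
  · refine mem_of_forall_mem_iff (hconf _ (h.conf_inr hx)) fun d => ?_
    constructor
    · rintro ⟨e, he, hd⟩
      obtain ⟨c, hc, rfl⟩ := hr (Sum.getRight?_eq_some_iff.1 hd)
      exact ⟨c, ⟨e, he, Sum.getRight?_eq_some_iff.2 hc⟩, rfl⟩
    · rintro ⟨c, ⟨e, he, hc⟩, rfl⟩
      refine ⟨e, he, Sum.getRight?_eq_some_iff.2 ?_⟩
      rw [Sum.getRight?_eq_some_iff.1 hc]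
      rfl
  · refine (h.conf_or hx).imp (fun h e he => ?_) (fun h c => ?_)
    · obtain ⟨c, hc⟩ := h e he
      exact ⟨c, by rw [hc]; rfl⟩
    · obtain ⟨e, he, hc⟩ := h c
      exact ⟨e, he, by rw [hc]; rfl⟩

theorem res {m : Mem N} {C : ConfStr N} {D : IdConfStr N ℕ} {L : ℕ → Option (Act N)} {a : N}
    {f : D.underlying.Ev → m.enc.underlying.Ev ⊕ C.Ev} (h : Embeds m C D L f)
    (ha : ∀ i α, L i = some α → α.Avoids a) : ∃ g, Embeds m (C.restrictName a) D L g := by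
  have hex : ∀ e, ∃ v : m.enc.underlying.Ev ⊕ (C.restrictName a).Ev,
      f e = Sum.map id Subtype.val v := by
    intro e
    cases he : f e with
    | inl c => exact ⟨Sum.inl c, rfl⟩
    | inr c =>
      refine ⟨Sum.inr ⟨c, ?_⟩, rfl⟩
      obtain ⟨α, hα, hα'⟩ := h.label e
      have := ha _ _ hα'
      change C.lab c ≠ _ ∧ C.lab c ≠ _
      rw [h.lab_inr he, hα]
      simpa [Act.Avoids] using this
  choose g hg using hex
  have hl : ∀ {e c}, g e = Sum.inl c → f e = Sum.inl c := by
    intro e c hc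
    rw [hg, hc]
    rfl
  have hr : ∀ {e c}, g e = Sum.inr c → f e = Sum.inr c.1 := by
    intro e c hc
    rw [hg, hc]
    rfl
  have hl' : ∀ {e c}, f e = Sum.inl c → g e = Sum.inl c := by
    intro e c hc
    rw [hg] at hc
    cases hge : g e with
    | inl c' => rw [hge] at hc; cases hc; rfl
    | inr c' => rw [hge] at hc; cases hc
  refine ⟨g, fun e e' hee => h.injective ?_, fun c => ?_, fun hc => h.ident_inl (hl hc),
    fun hc => h.ident_inr (hr hc), fun hc => h.lab_inl (hl hc), fun hc => h.lab_inr (hr hc),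
    h.label, fun {x} hx => ?_, fun {x} hx => ?_, fun {x} hx => ?_⟩
  · rw [hg, hg, hee]
  · obtain ⟨e, he⟩ := h.surjective c
    exact ⟨e, hl' he⟩
  · refine mem_of_forall_mem_iff (h.conf_inl hx) fun c => exists_congr fun e =>
      and_congr_right fun _ => Sum.getLeft?_eq_some_iff.trans
        (Iff.trans ⟨hl, hl'⟩ Sum.getLeft?_eq_some_iff.symm)
  · change Subtype.val '' _ ∈ C.conf
    refine mem_of_forall_mem_iff (h.conf_inr hx) fun c => ?_
    constructor
    · rintro ⟨c, ⟨e, he, hc⟩, rfl⟩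
      exact ⟨e, he, Sum.getRight?_eq_some_iff.2 (hr (Sum.getRight?_eq_some_iff.1 hc))⟩
    · rintro ⟨e, he, hc⟩
      have hc := Sum.getRight?_eq_some_iff.1 hc
      cases hge : g e with
      | inl c' => cases (hl hge).symm.trans hc
      | inr c' =>
        obtain rfl := Sum.inr_injective ((hr hge).symm.trans hc)
        exact ⟨c', ⟨e, he, Sum.getRight?_eq_some_iff.2 hge⟩, rfl⟩
  · refine (h.conf_or hx).imp (fun h e he => ?_) (fun h c => ?_)
    · obtain ⟨c, hc⟩ := h e he
      exact ⟨c, hl' hc⟩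
    · obtain ⟨e, he, hc⟩ := h c
      exact ⟨e, he, hl' hc⟩

/-- The last event of the memory becomes the first one of a prefix. -/
theorem guarded {m : Mem N} {i : ℕ} {l : Vis N} {Q : CCS N} {C : ConfStr N}
    {D : IdConfStr N ℕ} {L : ℕ → Option (Act N)}
    {f : D.underlying.Ev → (Mem.event i l Q m).enc.underlying.Ev ⊕ C.Ev}
    (h : Embeds (Mem.event i l Q m) C D L f) (hi : i ∉ m.ids) :
    ∃ g, Embeds m (ConfStr.guarded l C) D L g := by
  -- `φ` moves the newest memory event to the least event of the prefix and leaves all others in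
  -- place.
  let φ : Option m.enc.underlying.Ev ⊕ C.Ev → m.enc.underlying.Ev ⊕ Option C.Ev
    | Sum.inl none => Sum.inr none
    | Sum.inl (some c) => Sum.inl c
    | Sum.inr c => Sum.inr (some c)
  have hφ : Function.Injective φ := by
    rintro ((_ | c) | c) ((_ | c') | c') h <;> cases h <;> rfl
  have hl : ∀ {e c}, φ (f e) = Sum.inl c ↔ f e = Sum.inl (some c) := fun {e c} =>
    hφ.eq_iff (b := Sum.inl (some c))
  have hr₀ : ∀ {e}, φ (f e) = Sum.inr none ↔ f e = Sum.inl none := fun {e} =>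
    hφ.eq_iff (b := Sum.inl none)
  have hr : ∀ {e c}, φ (f e) = Sum.inr (some c) ↔ f e = Sum.inr c := fun {e c} =>
    hφ.eq_iff (b := Sum.inr c)
  -- Without the newest event the memory part is not full, so by `conf_or` nothing lies in `C`. With
  -- it, the memory part extends a maximal configuration of `m`, hence is full. These match the
  -- empty and the nonempty configurations of the prefix.
  have hconf : ∀ {x}, x ∈ D.underlying.conf →
      ((∀ e ∈ x, ∃ c, f e = Sum.inl (some c)) ∧
        {c | ∃ e ∈ x, f e = Sum.inl (some c)} ∈ m.enc.underlying.conf) ∨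
      ∀ c, ∃ e ∈ x, f e = Sum.inl c := by
    intro x hx
    have hor := h.conf_or hx
    rcases h.conf_inl hx with ⟨y, hy, hxy⟩ | ⟨y, hy, hxy⟩
    · have hnone : ∀ e ∈ x, f e ≠ Sum.inl none := by
        intro e he hfe
        have : none ∈ pimage (fun e => (f e).getLeft?) x :=
          ⟨e, he, Sum.getLeft?_eq_some_iff.2 hfe⟩
        rw [hxy] at this
        obtain ⟨c, -, hc⟩ := this
        cases hc
      refine Or.inl ⟨fun e he => ?_, ?_⟩
      · rcases hor with hor | hor
        · obtain ⟨_ | c, hc⟩ := hor e he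
          · exact (hnone e he hc).elim
          · exact ⟨c, hc⟩
        · obtain ⟨e, he, hc⟩ := hor none
          exact (hnone e he hc).elim
      · refine mem_of_forall_mem_iff hy fun c => ?_
        have := Set.ext_iff.1 hxy (some c)
        constructor
        · rintro ⟨e, he, hc⟩
          obtain ⟨c', hc', h⟩ := this.1 ⟨e, he, Sum.getLeft?_eq_some_iff.2 hc⟩
          exact Option.some_injective _ h ▸ hc'
        · intro hc
          obtain ⟨e, he, h⟩ := this.2 ⟨c, hc, rfl⟩
          exact ⟨e, he, Sum.getLeft?_eq_some_iff.1 h⟩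
    · refine Or.inr fun c => ?_
      obtain rfl := m.eq_univ_of_isMaximal hy
      have : c ∈ pimage (fun e => (f e).getLeft?) x := by
        rw [hxy]
        cases c with
        | none => exact Or.inl rfl
        | some c => exact Or.inr ⟨c, trivial, rfl⟩
      obtain ⟨e, he, h⟩ := this
      exact ⟨e, he, Sum.getLeft?_eq_some_iff.1 h⟩
  refine ⟨fun e => φ (f e), hφ.comp h.injective, fun c => ?_, fun hc => ?_, fun {e c} hc => ?_,
    fun hc => ?_, fun {e c} hc => ?_, h.label, fun {x} hx => ?_, fun {x} hx => ?_,
    fun {x} hx => ?_⟩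
  · obtain ⟨e, he⟩ := h.surjective (some c)
    exact ⟨e, hl.2 he⟩
  · exact h.ident_inl (hl.1 hc)
  · cases c with
    | none =>
      rw [h.ident_inl (hr₀.1 hc)]
      exact hi
    | some c => exact fun h' => h.ident_inr (hr.1 hc) (Or.inr h')
  · exact h.lab_inl (hl.1 hc)
  · cases c with
    | none => exact h.lab_inl (hr₀.1 hc)
    | some c => exact h.lab_inr (hr.1 hc)
  · have hiff : ∀ c, c ∈ pimage (fun e => (φ (f e)).getLeft?) x ↔
        ∃ e ∈ x, f e = Sum.inl (some c) := fun c =>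
      exists_congr fun e => and_congr_right fun _ => Sum.getLeft?_eq_some_iff.trans hl
    rcases hconf hx with ⟨-, h'⟩ | h'
    · exact mem_of_forall_mem_iff h' hiff
    · exact mem_of_forall_mem_iff m.univ_mem_conf fun c =>
        iff_of_true ((hiff c).2 (h' (some c))) trivial
  · rcases hconf hx with ⟨h', -⟩ | h'
    · refine Or.inl (Set.eq_empty_iff_forall_notMem.2 ?_)
      rintro c ⟨e, he, hc⟩
      obtain ⟨c', hc'⟩ := h' e he
      cases (hl.2 hc').symm.trans (Sum.getRight?_eq_some_iff.1 hc)
    · refine Or.inr ⟨_, h.conf_inr hx, ?_⟩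
      ext c
      cases c with
      | none =>
        obtain ⟨e, he, hc⟩ := h' none
        exact iff_of_true ⟨e, he, Sum.getRight?_eq_some_iff.2 (hr₀.2 hc)⟩ (Or.inl rfl)
      | some c =>
        constructor
        · rintro ⟨e, he, hc⟩
          exact Or.inr ⟨c, ⟨e, he, Sum.getRight?_eq_some_iff.2
            (hr.1 (Sum.getRight?_eq_some_iff.1 hc))⟩, rfl⟩
        · rintro (hc | ⟨c', ⟨e, he, hc⟩, hcc⟩)
          · cases hc
          · obtain rfl := Option.some_injective _ hcc
            exact ⟨e, he, Sum.getRight?_eq_some_iff.2 (hr.2 (Sum.getRight?_eq_some_iff.1 hc))⟩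
  · refine (hconf hx).imp (fun h' e he => ?_) (fun h' c => ?_)
    · obtain ⟨c, hc⟩ := h'.1 e he
      exact ⟨c, hl.2 hc⟩
    · obtain ⟨e, he, hc⟩ := h' (some c)
      exact ⟨e, he, hl.2 hc⟩

end Embeds

/-! ### Embeddings of parallel compositions over a common memory -/

namespace Embeds

variable {m : Mem N} {C₁ C₂ : ConfStr N} {R S : RCCS N}
  {f₁ : R.encMem.underlying.Ev → m.enc.underlying.Ev ⊕ C₁.Ev}
  {f₂ : S.encMem.underlying.Ev → m.enc.underlying.Ev ⊕ C₂.Ev}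

theorem eq_of_getRight?_eq {D : IdConfStr N ℕ} {C : ConfStr N} {L : ℕ → Option (Act N)}
    {f : D.underlying.Ev → m.enc.underlying.Ev ⊕ C.Ev} (h : Embeds m C D L f)
    {e e' : D.underlying.Ev} {c : C.Ev} (he : (f e).getRight? = some c)
    (he' : (f e').getRight? = some c) : e = e' :=
  h.injective ((Sum.getRight?_eq_some_iff.1 he).trans (Sum.getRight?_eq_some_iff.1 he').symm)

theorem of_fork {D : IdConfStr N ℕ} {C : ConfStr N} {L : ℕ → Option (Act N)}
    {f : D.underlying.Ev → m.enc.underlying.Ev ⊕ C.Ev} (h : Embeds m.fork C D L f) :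
    Embeds m C D L f :=
  ⟨h.injective, h.surjective, h.ident_inl, h.ident_inr, h.lab_inl, h.lab_inr, h.label,
    h.conf_inl, h.conf_inr, h.conf_or⟩

theorem exists_inr {D : IdConfStr N ℕ} {C : ConfStr N} {L : ℕ → Option (Act N)}
    {f : D.underlying.Ev → m.enc.underlying.Ev ⊕ C.Ev} (h : Embeds m C D L f)
    {e : D.underlying.Ev} (he : D.ident e ∉ m.ids) : ∃ c, f e = Sum.inr c := by
  cases hfe : f e with
  | inl c => exact (he (h.ident_inl hfe ▸ m.ident_mem_ids c)).elim
  | inr c => exact ⟨c, rfl⟩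

theorem exists_inl {D : IdConfStr N ℕ} {C : ConfStr N} {L : ℕ → Option (Act N)}
    {f : D.underlying.Ev → m.enc.underlying.Ev ⊕ C.Ev} (h : Embeds m C D L f) (hm : m.Nodup)
    {e : D.underlying.Ev} {c : m.enc.underlying.Ev} (he : D.ident e = m.enc.ident c) :
    f e = Sum.inl c := by
  cases hfe : f e with
  | inl c' => rw [hm.ident_injective ((h.ident_inl hfe).symm.trans he)]
  | inr c' => exact (h.ident_inr hfe (he ▸ m.ident_mem_ids c)).elim

/-- An event of a parallel composition is a shared event of the memory or an event of the parallel
composition of the encodings. -/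
theorem par_cases (hm : m.Nodup) (h₁ : Embeds m C₁ R.encMem R.label f₁)
    (h₂ : Embeds m C₂ S.encMem S.label f₂) (hs : RCCS.Synchronised m R S)
    (e : (R.encMem.par S.encMem).underlying.Ev) :
    ∃ v : m.enc.underlying.Ev ⊕ (C₁.par C₂).Ev,
      (∀ c, v = Sum.inl c → ∃ a b, e.1 = StarProd.both a b ∧ f₁ a = Sum.inl c ∧
        f₂ b = Sum.inl c ∧
        m.enc.underlying.lab c = (R.encMem.par S.encMem).underlying.lab e) ∧
      (∀ t, v = Sum.inr t →
        StarProd.pmap (fun a => (f₁ a).getRight?) (fun b => (f₂ b).getRight?) e.1 = some t.1 ∧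
        (R.encMem.par S.encMem).ident e ∉ m.ids ∧
        (C₁.par C₂).lab t = (R.encMem.par S.encMem).underlying.lab e) ∧
      ∃ α, (R.encMem.par S.encMem).underlying.lab e = Lab.act α ∧
        (RCCS.par R S).label ((R.encMem.par S.encMem).ident e) = some α := by
  have hlab := IdConfStr.some_lab_par e
  obtain ⟨a | b | ⟨a, b⟩, he⟩ := e
  · have hne := ne_of_validate_left (D₁ := R.encMem) (D₂ := S.encMem) he
    have hl := hlab.trans (validate_left hne)
    obtain ⟨α, hα, hα'⟩ := h₁.label a
    rw [hα] at hl
    have hS : S.label (R.encMem.ident a) = none := S.label_eq_none fun b hb => hne b hb.symm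
    have hlabel : (RCCS.par R S).label (R.encMem.ident a) = some α := by
      change mergeAct _ _ = _
      rw [hS, hα', mergeAct_none_right]
    cases hfa : f₁ a with
    | inl c =>
      -- An event of the common memory cannot be unpaired: the other component has a copy of it with
      -- the same identifier.
      obtain ⟨b, hb⟩ := h₂.surjective c
      exact (hne b ((h₁.ident_inl hfa).trans (h₂.ident_inl hb).symm)).elim
    | inr c =>
      have hsync : synchronise ((C₁.prod C₂).lab (StarProd.left c)) = some (Lab.act α) := by
        change synchronise (C₁.lab c) = _
        rw [h₁.lab_inr hfa, hα]
        rfl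
      refine ⟨Sum.inr ⟨StarProd.left c, Option.isSome_iff_exists.2 ⟨_, hsync⟩⟩,
        fun c' hc => (by cases hc), fun t ht => ?_, α, Option.some_injective _ hl, hlabel⟩
      cases ht
      refine ⟨(StarProd.pmap_eq_some_iff _ _ _ _).2 ⟨?_, rfl⟩, h₁.ident_inr hfa,
        Option.some_injective _ (((ConfStr.some_lab_par _).trans hsync).trans hl.symm)⟩
      exact (Sum.getRight?_eq_some_iff.2 hfa).symm
  · have hne := ne_of_validate_right (D₁ := R.encMem) (D₂ := S.encMem) he
    have hl := hlab.trans (validate_right hne)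
    obtain ⟨α, hα, hα'⟩ := h₂.label b
    rw [hα] at hl
    have hR : R.label (S.encMem.ident b) = none := R.label_eq_none fun a ha => hne a ha
    have hlabel : (RCCS.par R S).label (S.encMem.ident b) = some α := by
      change mergeAct _ _ = _
      rw [hR, hα', mergeAct_none_left]
    cases hfb : f₂ b with
    | inl c =>
      obtain ⟨a, ha⟩ := h₁.surjective c
      exact (hne a ((h₁.ident_inl ha).trans (h₂.ident_inl hfb).symm)).elim
    | inr c =>
      have hsync : synchronise ((C₁.prod C₂).lab (StarProd.right c)) = some (Lab.act α) := by
        change synchronise (C₂.lab c) = _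
        rw [h₂.lab_inr hfb, hα]
        rfl
      refine ⟨Sum.inr ⟨StarProd.right c, Option.isSome_iff_exists.2 ⟨_, hsync⟩⟩,
        fun c' hc => (by cases hc), fun t ht => ?_, α, Option.some_injective _ hl, hlabel⟩
      cases ht
      refine ⟨(StarProd.pmap_eq_some_iff _ _ _ _).2 ⟨rfl, ?_⟩, h₂.ident_inr hfb,
        Option.some_injective _ (((ConfStr.some_lab_par _).trans hsync).trans hl.symm)⟩
      exact (Sum.getRight?_eq_some_iff.2 hfb).symm
  · have heq := eq_of_validate_both (D₁ := R.encMem) (D₂ := S.encMem) he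
    obtain ⟨α, hα, hα'⟩ := h₁.label a
    obtain ⟨β, hβ, hβ'⟩ := h₂.label b
    rw [← heq] at hβ'
    cases hfa : f₁ a with
    | inl c =>
      -- Identifiers are unique in `m`, so both components of the pair are copies of the same memory
      -- event and have the same label: this is a fork.
      have hfb := h₂.exists_inl hm (heq.symm.trans (h₁.ident_inl hfa))
      obtain rfl : α = β := by
        have := (h₁.lab_inl hfa).symm.trans (h₂.lab_inl hfb)
        rw [hα, hβ] at this
        exact Lab.act.inj this
      have hl := Option.some_injective _ (hlab.trans (validate_both_same heq hα hβ))
      refine ⟨Sum.inl c, fun c' hc => ?_, fun t ht => (by cases ht), α, hl, ?_⟩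
      · cases hc
        exact ⟨a, b, rfl, hfa, hfb, (h₁.lab_inl hfa).trans (hα.trans hl.symm)⟩
      · change mergeAct (R.label (R.encMem.ident a)) (S.label (R.encMem.ident a)) = _
        rw [hα', hβ', mergeAct_self]
    | inr c =>
      have hi := h₁.ident_inr hfa
      obtain ⟨d, hfb⟩ := h₂.exists_inr (heq ▸ hi)
      -- Outside `m` a shared identifier comes from a synchronisation, so the pair survives in
      -- `C₁.par C₂` with label `τ`.
      obtain ⟨l, rfl, rfl⟩ := hs _ hi α β hα' hβ'
      have hl := hlab.trans (validate_both_bar heq hα hβ)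
      have hsync : synchronise ((C₁.prod C₂).lab (StarProd.both c d)) =
          some (Lab.act Act.tau) := by
        change synchronise (Lab.pair (C₁.lab c) (C₂.lab d)) = _
        rw [h₁.lab_inr hfa, h₂.lab_inr hfb, hα, hβ]
        exact if_pos rfl
      refine ⟨Sum.inr ⟨StarProd.both c d, Option.isSome_iff_exists.2 ⟨_, hsync⟩⟩,
        fun c' hc => (by cases hc), fun t ht => ?_, Act.tau, Option.some_injective _ hl, ?_⟩
      · cases ht
        refine ⟨(StarProd.pmap_eq_some_iff _ _ _ _).2 ⟨?_, ?_⟩, hi,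
          Option.some_injective _ (((ConfStr.some_lab_par _).trans hsync).trans hl.symm)⟩
        · exact (Sum.getRight?_eq_some_iff.2 hfa).symm
        · exact (Sum.getRight?_eq_some_iff.2 hfb).symm
      · change mergeAct (R.label (R.encMem.ident a)) (S.label (R.encMem.ident a)) = _
        rw [hα', hβ', mergeAct_bar]

/-- Injectivity of `p` alone is not enough, since `bind` gives `none` both for an absent argument
and for an undefined value; `ho` and `ho'` exclude the second case. -/
theorem _root_.Option.eq_of_bind_eq {A B : Type} {p : A → Option B}
    (hp : ∀ a a' c, p a = some c → p a' = some c → a = a') {o o' : Option A}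
    (ho : ∀ a, o = some a → ∃ c, p a = some c) (ho' : ∀ a, o' = some a → ∃ c, p a = some c)
    (h : o.bind p = o'.bind p) : o = o' := by
  cases o with
  | none =>
    cases o' with
    | none => rfl
    | some a' =>
      obtain ⟨c, hc⟩ := ho' a' rfl
      simp [hc] at h
  | some a =>
    obtain ⟨c, hc⟩ := ho a rfl
    cases o' with
    | none => simp [hc] at h
    | some a' =>
      simp only [Option.bind_some, hc] at h
      rw [hp a a' c hc h.symm]

theorem par (h₁ : Embeds m C₁ R.encMem R.label f₁) (hm : m.Nodup)
    (h₂ : Embeds m C₂ S.encMem S.label f₂) (hs : RCCS.Synchronised m R S) :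
    ∃ g, Embeds m (C₁.par C₂) (R.encMem.par S.encMem) (RCCS.par R S).label g := by
  choose g hl hr hlabel using par_cases hm h₁ h₂ hs
  have fst_inr : ∀ {e t}, g e = Sum.inr t → ∀ a, e.1.fst = some a →
      ∃ c, (f₁ a).getRight? = some c := by
    intro e t ht a ha
    have hi := (hr e t ht).2.1
    rw [ident_of_fst ha] at hi
    obtain ⟨c, hc⟩ := h₁.exists_inr hi
    exact ⟨c, Sum.getRight?_eq_some_iff.2 hc⟩
  have snd_inr : ∀ {e t}, g e = Sum.inr t → ∀ b, e.1.snd = some b →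
      ∃ c, (f₂ b).getRight? = some c := by
    intro e t ht b hb
    have hi := (hr e t ht).2.1
    rw [ident_of_snd hb] at hi
    obtain ⟨c, hc⟩ := h₂.exists_inr hi
    exact ⟨c, Sum.getRight?_eq_some_iff.2 hc⟩
  have fst_inl : ∀ {e a c}, e.1.fst = some a → f₁ a = Sum.inl c → g e = Sum.inl c := by
    intro e a c ha hc
    cases hge : g e with
    | inl c' =>
      obtain ⟨a', b', he, hfa, -⟩ := hl e c' hge
      rw [he] at ha
      obtain rfl := Option.some_injective _ ha
      rw [Sum.inl_injective (hfa.symm.trans hc)]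
    | inr t =>
      obtain ⟨d, hd⟩ := fst_inr hge a ha
      cases hc.symm.trans (Sum.getRight?_eq_some_iff.1 hd)
  have snd_inl : ∀ {e b c}, e.1.snd = some b → f₂ b = Sum.inl c → g e = Sum.inl c := by
    intro e b c hb hc
    cases hge : g e with
    | inl c' =>
      obtain ⟨a', b', he, -, hfb, -⟩ := hl e c' hge
      rw [he] at hb
      obtain rfl := Option.some_injective _ hb
      rw [Sum.inl_injective (hfb.symm.trans hc)]
    | inr t =>
      obtain ⟨d, hd⟩ := snd_inr hge b hb
      cases hc.symm.trans (Sum.getRight?_eq_some_iff.1 hd)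
  refine ⟨g, fun e e' hee => ?_, fun c => ?_, fun {e c} hc => ?_, fun {e c} hc => (hr e c hc).2.1,
    fun {e c} hc => ?_, fun {e c} hc => (hr e c hc).2.2, hlabel, fun {x} hx => ?_,
    fun {x} hx => ?_, fun {x} hx => ?_⟩
  · cases hge : g e with
    | inl c =>
      obtain ⟨a, b, he, ha, hb, -⟩ := hl e c hge
      obtain ⟨a', b', he', ha', hb', -⟩ := hl e' c (hee.symm.trans hge)
      apply Subtype.ext
      rw [he, he', h₁.injective (ha.trans ha'.symm), h₂.injective (hb.trans hb'.symm)]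
    | inr t =>
      have hge' := hee.symm.trans hge
      obtain ⟨h₃, h₄⟩ := (StarProd.pmap_eq_some_iff _ _ _ _).1 (hr e t hge).1
      obtain ⟨h₅, h₆⟩ := (StarProd.pmap_eq_some_iff _ _ _ _).1 (hr e' t hge').1
      exact Subtype.ext (StarProd.ext_proj
        (Option.eq_of_bind_eq (fun _ _ _ => h₁.eq_of_getRight?_eq) (fst_inr hge) (fst_inr hge')
          (h₃.symm.trans h₅))
        (Option.eq_of_bind_eq (fun _ _ _ => h₂.eq_of_getRight?_eq) (snd_inr hge) (snd_inr hge')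
          (h₄.symm.trans h₆)))
  · obtain ⟨a, ha⟩ := h₁.surjective c
    obtain ⟨b, hb⟩ := h₂.surjective c
    exact ⟨⟨StarProd.both a b,
      isSome_validate_both ((h₁.ident_inl ha).trans (h₂.ident_inl hb).symm)⟩, fst_inl rfl ha⟩
  · obtain ⟨a, b, he, ha, -⟩ := hl e c hc
    rw [ident_of_fst (congrArg StarProd.fst he), h₁.ident_inl ha]
  · obtain ⟨a, b, -, -, -, h⟩ := hl e c hc
    exact h
  · change Subtype.val '' x ∈ (R.encMem.underlying.prod S.encMem.underlying).conf at hx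
    refine mem_of_forall_mem_iff (h₁.conf_inl hx.1.1) fun c => ⟨?_, ?_⟩
    · rintro ⟨e, he, hc⟩
      obtain ⟨a, b, hab, ha, -⟩ := hl e c (Sum.getLeft?_eq_some_iff.1 hc)
      exact ⟨a, ⟨e.1, ⟨e, he, rfl⟩, congrArg StarProd.fst hab⟩, Sum.getLeft?_eq_some_iff.2 ha⟩
    · rintro ⟨a, ⟨_, ⟨e, he, rfl⟩, ha⟩, hc⟩
      exact ⟨e, he, Sum.getLeft?_eq_some_iff.2 (fst_inl ha (Sum.getLeft?_eq_some_iff.1 hc))⟩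
  · change Subtype.val '' x ∈ (R.encMem.underlying.prod S.encMem.underlying).conf at hx
    -- The two partial maps forget the memory events, and so does their action on pairs: a memory
    -- event has both components in `m`.
    have hx' := pimage_mem_prod_conf (C := C₁) (D := C₂) (fun _ _ _ => h₁.eq_of_getRight?_eq)
      (fun _ _ _ => h₂.eq_of_getRight?_eq) (fun _ => h₁.conf_inr) (fun _ => h₂.conf_inr) hx
    change Subtype.val '' _ ∈ (C₁.prod C₂).conf
    refine mem_of_forall_mem_iff hx' fun s => ⟨?_, ?_⟩
    · rintro ⟨t, ⟨e, he, ht⟩, rfl⟩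
      exact ⟨e.1, ⟨e, he, rfl⟩, (hr e t (Sum.getRight?_eq_some_iff.1 ht)).1⟩
    · rintro ⟨_, ⟨e, he, rfl⟩, hs⟩
      cases hge : g e with
      | inl c =>
        obtain ⟨a, b, hab, ha, hb, -⟩ := hl e c hge
        rw [hab] at hs
        simp [StarProd.pmap, StarProd.fst, StarProd.snd, ha, hb, StarProd.mk?] at hs
      | inr t =>
        exact ⟨t, ⟨e, he, Sum.getRight?_eq_some_iff.2 hge⟩,
          Option.some_injective _ ((hr e t hge).1.symm.trans hs)⟩
  · change Subtype.val '' x ∈ (R.encMem.underlying.prod S.encMem.underlying).conf at hx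
    -- One side having performed all of `m` is enough, since memory events occur only as pairs. If
    -- neither has, every event has a component in `m` and so is a memory event.
    rcases h₁.conf_or hx.1.1 with h₃ | h₃
    · rcases h₂.conf_or hx.1.2 with h₄ | h₄
      · refine Or.inl fun e he => ?_
        rcases e.1.fst_or_snd with ⟨a, ha⟩ | ⟨b, hb⟩
        · obtain ⟨c, hc⟩ := h₃ a ⟨e.1, ⟨e, he, rfl⟩, ha⟩
          exact ⟨c, fst_inl ha hc⟩
        · obtain ⟨c, hc⟩ := h₄ b ⟨e.1, ⟨e, he, rfl⟩, hb⟩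
          exact ⟨c, snd_inl hb hc⟩
      · refine Or.inr fun c => ?_
        obtain ⟨b, ⟨_, ⟨e, he, rfl⟩, hb⟩, hc⟩ := h₄ c
        exact ⟨e, he, snd_inl hb hc⟩
    · refine Or.inr fun c => ?_
      obtain ⟨a, ⟨_, ⟨e, he, rfl⟩, ha⟩, hc⟩ := h₃ c
      exact ⟨e, he, fst_inl ha hc⟩

end Embeds

/-- Each constructor of `Rollback` has its counterpart for `Embeds`. Uniqueness of identifiers
passes to the longer memory in `undo` by the freshness of `i`. -/
theorem RCCS.Rollback.exists_embeds {m : Mem N} {P : CCS N} {R : RCCS N} (h : Rollback m P R)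
    (hm : m.Nodup) : ∃ f, Embeds m P.enc R.encMem R.label f := by
  induction h with
  | thread m P => exact ⟨_, Embeds.thread hm P.empty_mem_enc_conf⟩
  | undo _ hs hi ih =>
    obtain ⟨f, hf⟩ := ih ⟨hi, hm⟩
    obtain ⟨g, hg⟩ := hf.guarded hi
    exact hg.of_included hs.included
  | par _ _ hs ih ih' =>
    obtain ⟨f, hf⟩ := ih hm
    obtain ⟨g, hg⟩ := ih' hm
    exact hf.of_fork.par hm hg.of_fork hs
  | res _ _ ha ih =>
    obtain ⟨f, hf⟩ := ih hm
    exact hf.res ha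
  | equiv _ he ih =>
    obtain ⟨f, hf⟩ := ih hm
    exact hf.of_included (Iso.included he)

end RevCCS

theorem mainTheorem4 {N : Type*} (P : RevCCS.CCS N) (R : RevCCS.RCCS N)
    (hR : RevCCS.RCCS.IsOrigin P R) :
    RevCCS.ConfStr.Included R.encMem.underlying P.enc := by
  obtain ⟨f, hf⟩ := (RevCCS.RCCS.Rollback.of_isOrigin hR).exists_embeds trivial
  -- The empty memory has no identifiers, so every event lands in the encoding of `P`.
  have hex : ∀ e, ∃ c, f e = Sum.inr c := fun e => hf.exists_inr fun h => h
  choose g hg using hex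
  refine ⟨g, fun e e' h => hf.injective ?_, fun x hx => ?_, fun e => hf.lab_inr (hg e)⟩
  · rw [hg, hg, h]
  · refine RevCCS.mem_of_forall_mem_iff (hf.conf_inr hx) fun c =>
      exists_congr fun e => and_congr_right fun _ =>
        Iff.trans ⟨fun h => h ▸ hg e, fun h => Sum.inr_injective ((hg e).symm.trans h)⟩
          Sum.getRight?_eq_some_iff.symm
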